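/- **Setting.** Two players with finite nonempty action sets $\mathcal A^1,\mathcal A^2$, $A_{\max}=\max(|\mathcal A^1|,|\mathcal A^2|)\ge 2$, play a zero-sum matrix game with payoff matrices $R^1,R^2$, $R^1+(R^2)^\top=0$ and $|R^i(a,b)|\le 1$. For mixed strategies $\pi=(\pi^1,\pi^2)$ the Nash gap is $\mathrm{NG}(\pi)=\sum_{i}\max_{\hat\pi\in\Delta^i}(\hat\pi-\pi^i)^\top R^i\pi^{-i}$. Given $\tau,c_{\alpha,\beta}>0$ and stepsizes $\beta_k$, put $\alpha_k=\beta_k/c_{\alpha,\beta}$, start with $\pi^i_1$ uniform and $q^i_1=0$, and in each round $k=1,2,\dots$ let the players draw actions $A^i_k\sim\pi^i_k$ independently (given the past) and update $$\pi^i_{k+1}=\pi^i_k+\beta_k\big(\sigma_\tau(q^i_k)-\pi^i_k\big),\qquad q^i_{k+1}=q^i_k+\alpha_k\frac{e^i(A^i_k)}{\pi^i_k(A^i_k)}\big(R^i(A^i_k,A^{-i}_k)-q^i_k(A^i_k)\big),$$ where $\sigma_\tau(q)(a)=e^{q(a)/\tau}/\sum_{a'}e^{q(a')/\tau}$ and $e^i(a)$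 is the standard basis vector. The iteration complexity $K(\epsilon)$ is the least $K\ge 0$ with $\mathbb E\,\mathrm{NG}(\pi_{K+1})\le\epsilon$. Let $H$ be the Shannon entropy and let $T_1=\sum_i\max_{\hat\pi\in\Delta^i}\{\langle\hat\pi,R^i\pi_1^{-i}\rangle+\tau H(\hat\pi)\}+\sum_i\|q^i_1-R^i\pi^{-i}_1\|_2^2$. **Theorem.** There are numerical constants $c_1,c_2,c_3>0$, a function $C(\eta)>0$ on $(0,1)$ and positive functions $g_\tau,g_{\alpha,\beta},g_1,g_2,g_3$ of $\nu>0$, with $g_1,g_3$ non-decreasing and $g_1(\nu)\to0$ as $\nu\to0^+$, such that the following holds for every such game, every $\nu>0$ and every $\epsilon\in(0,1)$. Run the dynamics with $$\tau=\frac{g_\tau(\nu)\,\epsilon}{12\log A_{\max}},\qquad c_{\alpha,\beta}=\frac{g_{\alpha,\beta}(\nu)\,\tau^3}{6A_{\max}^2}\in(0,1).$$ (a) *Constant stepsize* $\beta_k\equiv\beta=\frac{g_1(\nu)\epsilon^{8+\nu}}{c_1A_{\max}^{10}}$. Then $\beta\in(0,1)$, $g_3(\nu)\beta<1$, one has $\mathbb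 E\,\mathrm{NG}(\pi_{K+1})\le\epsilon$ for $K=\max\Big\{0,\Big\lceil\frac{\log(\epsilon/(3T_1))}{\log(1-g_3(\nu)\beta)}\Big\rceil\Big\}$, and $$K(\epsilon)\le\frac{c_2A_{\max}^{10}}{g_2(\nu)\,\epsilon^{8+\nu}}\Big(1+\log\frac1\epsilon\Big).$$ (b) *Inverse polynomial stepsizes* $\beta_k=\frac{\beta}{(k+k_0)^\eta}$ with $\eta\in(0,1)$ and $\beta=\frac{g_1(\nu)\epsilon^{8+\nu}}{c_3A_{\max}^{10}}$. Then $\beta\in(0,1)$. For every real $k_0\ge(2\eta/\beta)^{1/(1-\eta)}$ one has $\mathbb E\,\mathrm{NG}(\pi_{K+1})\le\epsilon$ for $$K=\Big\lceil\Big\{\frac{1}{g_3(\nu)}\frac{1-\eta}{\beta}\max\Big(0,\log\frac{3T_1}{\epsilon}\Big)+(1+k_0)^{1-\eta}\Big\}^{\frac1{1-\eta}}-k_0-1\Big\rceil,$$ and for $k_0=\lceil(2\eta/\beta)^{1/(1-\eta)}\rceil$, $$K(\epsilon)\le C(\eta)\Big(\frac{A_{\max}^{10}}{g_2(\nu)\,\epsilon^{8+\nu}}\Big(1+\log\frac1\epsilon\Big)\Big)^{1/(1-\eta)}.$$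 -/

import Mathlib

open scoped BigOperators Topology

noncomputable section

/-- A two-player zero-sum matrix game with finite action sets `A` (player 1) and `B` (player 2):
`R₁ a b` and `R₂ b a` are the payoffs of the two players when they play `a` and `b`.
The payoffs are normalised to `[-1, 1]`. -/
structure ZeroSumGame (A B : Type*) where
  R₁ : Matrix A B ℝ
  R₂ : Matrix B A ℝ
  zero_sum : R₁ + R₂.transpose = 0
  bounded : ∀ a b, |R₁ a b| ≤ 1

/-- The largest number of actions of a player. -/
def Amax (A B : Type*) [Fintype A] [Fintype B] : ℕ := max (Fintype.card A) (Fintype.card B)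

/-- Shannon entropy `-∑ p(a) log p(a)`. -/
def shannonEntropy {A : Type*} [Fintype A] (p : A → ℝ) : ℝ := -∑ a, p a * Real.log (p a)

/-- The smoothed best response (softmax) at temperature `τ`. -/
def softmax {A : Type*} [Fintype A] (τ : ℝ) (q : A → ℝ) (a : A) : ℝ :=
  Real.exp (q a / τ) / ∑ a', Real.exp (q a' / τ)

/-- The best gain of a player with payoff matrix `M` from deviating from the mixed strategy `p`
against the opponent's mixed strategy `p'`: the maximum of `⟨x - p, M p'⟩` over the simplex. -/
def bestGain {A B : Type*} [Fintype A] [Fintype B] (M : Matrix A B ℝ) (p : A → ℝ) (p' : B → ℝ) :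
    ℝ :=
  sSup ((fun x : A → ℝ => (x - p) ⬝ᵥ M.mulVec p') '' stdSimplex ℝ A)

/-- The maximum of `⟨x, M p'⟩ + τ H(x)` over the simplex. -/
def regularizedBestValue {A B : Type*} [Fintype A] [Fintype B] (τ : ℝ) (M : Matrix A B ℝ)
    (p' : B → ℝ) : ℝ :=
  sSup ((fun x : A → ℝ => x ⬝ᵥ M.mulVec p' + τ * shannonEntropy x) '' stdSimplex ℝ A)

/-- The mixed strategies `p₁`, `p₂` and the local `q`-values `q₁`, `q₂` of the two players. -/
structure PlayState (A B : Type*) where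
  p₁ : A → ℝ
  p₂ : B → ℝ
  q₁ : A → ℝ
  q₂ : B → ℝ

/-- Uniform strategies and zero `q`-values. -/
def initialState (A B : Type*) [Fintype A] [Fintype B] : PlayState A B where
  p₁ := fun _ => 1 / (Fintype.card A : ℝ)
  p₂ := fun _ => 1 / (Fintype.card B : ℝ)
  q₁ := 0
  q₂ := 0

/-- The smoothed best-response update `p + β (σ_τ(q) - p)`. -/
def strategyUpdate {A : Type*} [Fintype A] (τ β : ℝ) (p q : A → ℝ) : A → ℝ :=
  p + β • (softmax τ q - p)

/-- The importance-weighted TD update `q + α (e_a / p(a)) (r - q(a))` after the action `a` was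
played and the payoff `r` was received. -/
def tdUpdate {A : Type*} [DecidableEq A] (α : ℝ) (p q : A → ℝ) (a : A) (r : ℝ) : A → ℝ :=
  q + (α / p a * (r - q a)) • (Pi.single a 1 : A → ℝ)

namespace ZeroSumGame

variable {A B : Type*} [Fintype A] [Fintype B]

/-- The Nash gap of a pair of mixed strategies. -/
def nashGap (G : ZeroSumGame A B) (p₁ : A → ℝ) (p₂ : B → ℝ) : ℝ :=
  bestGain G.R₁ p₁ p₂ + bestGain G.R₂ p₂ p₁

/-- The Lyapunov function `V` of the strategies. -/
def lyapunovV (G : ZeroSumGame A B) (τ : ℝ) (s : PlayState A B) : ℝ :=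
  regularizedBestValue τ G.R₁ s.p₂ + regularizedBestValue τ G.R₂ s.p₁

/-- The Lyapunov function `W` of the `q`-values. -/
def lyapunovW (G : ZeroSumGame A B) (s : PlayState A B) : ℝ :=
  (∑ a, (s.q₁ a - G.R₁.mulVec s.p₂ a) ^ 2) + ∑ b, (s.q₂ b - G.R₂.mulVec s.p₁ b) ^ 2

/-- The total Lyapunov function `V + W` at the initial state. -/
def initialLyapunov (G : ZeroSumGame A B) (τ : ℝ) : ℝ :=
  G.lyapunovV τ (initialState A B) + G.lyapunovW (initialState A B)

variable [DecidableEq A] [DecidableEq B]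

/-- One round of the minimal-information dynamics in which the actions `a.1` and `a.2` are played,
with step size `β` for the strategies and `α = β / c` for the `q`-values. -/
def step (G : ZeroSumGame A B) (τ c β : ℝ) (s : PlayState A B) (a : A × B) : PlayState A B where
  p₁ := strategyUpdate τ β s.p₁ s.q₁
  p₂ := strategyUpdate τ β s.p₂ s.q₂
  q₁ := tdUpdate (β / c) s.p₁ s.q₁ a.1 (G.R₁ a.1 a.2)
  q₂ := tdUpdate (β / c) s.p₂ s.q₂ a.2 (G.R₂ a.2 a.1)

/-- The state `(π_{K+1}, q_{K+1})` after the rounds `1, …, K`, as a function of the history of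
the actions played in these rounds (round `k` has the step size `β k`). -/
def stateAfter (G : ZeroSumGame A B) (τ c : ℝ) (β : ℕ → ℝ) :
    (K : ℕ) → (Fin K → A × B) → PlayState A B
  | 0, _ => initialState A B
  | K + 1, h =>
    G.step τ c (β (K + 1)) (G.stateAfter τ c β K fun j => h j.castSucc) (h (Fin.last K))

/-- The probability of a history of actions: given the past, the two players draw their actions
independently from their current mixed strategies. -/
def historyProb (G : ZeroSumGame A B) (τ c : ℝ) (β : ℕ → ℝ) : (K : ℕ) → (Fin K → A × B) → ℝ
  | 0, _ => 1
  | K + 1, h =>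
    G.historyProb τ c β K (fun j => h j.castSucc) *
      ((G.stateAfter τ c β K fun j => h j.castSucc).p₁ (h (Fin.last K)).1 *
        (G.stateAfter τ c β K fun j => h j.castSucc).p₂ (h (Fin.last K)).2)

/-- The expected Nash gap `E NG(π_{K+1})` after `K` rounds. -/
def expectedNashGap (G : ZeroSumGame A B) (τ c : ℝ) (β : ℕ → ℝ) (K : ℕ) : ℝ :=
  ∑ h : Fin K → A × B, G.historyProb τ c β K h *
    G.nashGap (G.stateAfter τ c β K h).p₁ (G.stateAfter τ c β K h).p₂

/-- `K` is the iteration complexity at accuracy `ε`: the least number of rounds `K` with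
`E NG(π_{K+1}) ≤ ε`. -/
def IsIterationComplexity (G : ZeroSumGame A B) (τ c : ℝ) (β : ℕ → ℝ) (ε : ℝ) (K : ℕ) : Prop :=
  IsLeast {k : ℕ | G.expectedNashGap τ c β k ≤ ε} K

end ZeroSumGame

/-- The inverse polynomial step sizes `β / (k + k₀) ^ η`. -/
def polyStep (β k₀ η : ℝ) (k : ℕ) : ℝ := β / ((k : ℝ) + k₀) ^ η

/-- The explicit number of rounds for constant step sizes, with `T` the initial value of the total
Lyapunov function and `g` the contraction factor. -/
def roundsConst (T ε g β : ℝ) : ℕ :=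
  ⌈Real.log (ε / (3 * T)) / Real.log (1 - g * β)⌉₊

/-- The explicit number of rounds for inverse polynomial step sizes. The maximum with `0` only
matters when `3 T < ε`, where no round is needed. -/
def roundsPoly (T ε g β k₀ η : ℝ) : ℕ :=
  ⌈(1 / g * ((1 - η) / β) * max 0 (Real.log (3 * T / ε)) + (1 + k₀) ^ (1 - η)) ^ (1 / (1 - η))
    - k₀ - 1⌉₊

end

set_option linter.unusedSectionVars false

/-! The proof follows the Lyapunov function `L = V + W / A_max`. By Gibbs' variational principle `V`
is a sum of two log-sum-exps. It dominates the Nash gap because in a zero-sum game the two realised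
payoffs cancel. Smoothness of log-sum-exp makes `V` contract at rate `β`, up to a bias of order `τ
log A_max`: if each player responded to the exact payoff vector, the payoffs of the two smoothed
responses would cancel as well. Responding to `q` instead costs a multiple of `W`, since softmax is
Lipschitz. `W` contracts at the faster rate `β / c`, because importance weighting makes the TD step
unbiased. Its noise is of order `(β / c)² / m` when every action has probability at least `m`. For
small `c` the surplus contraction of `W` pays for its cost in `V`, so in expectation `L` goes to at
most `(1 - β) L + β E`.

The crux is `m`. The lower bound that softmax itself provides is exponentially small in `1 / τ`. But
play starts uniform and a round shrinks a probability by at most `1 - β`, so after `k` rounds it is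
at least `decayProd β k / A_max`. This same product measures the decay of the initial value of `L`.
The horizon ends as soon as the product is known to be below `ε / (3T)`, so before that it stays
above `ε / (36 A_max)`, and `m` is polynomial in `ε` throughout. The noise in `E` is then of order
`β A_max² / (c² ε)` with `c` of order `τ³`, that is `ε³` up to factors in `A_max`; keeping it below
`ε` forces `β` of order `ε ^ 8`. The exponent `ν` is pure slack. -/

/-- The log-sum-exp function at temperature `τ`. -/
noncomputable def logSumExp {A : Type*} [Fintype A] (τ : ℝ) (y : A → ℝ) : ℝ :=
  τ * Real.log (∑ a, Real.exp (y a / τ))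

/-! ### Softmax and log-sum-exp: duality, smoothness, Lipschitz bounds. -/

section Softmax

variable {A B : Type*} [Fintype A] [Fintype B]

theorem sum_exp_pos [Nonempty A] (y : A → ℝ) : 0 < ∑ a, Real.exp (y a) :=
  Finset.sum_pos (fun _ _ => Real.exp_pos _) Finset.univ_nonempty

theorem softmax_pos [Nonempty A] (τ : ℝ) (y : A → ℝ) (a : A) : 0 < softmax τ y a :=
  div_pos (Real.exp_pos _) (sum_exp_pos _)

theorem sum_softmax [Nonempty A] (τ : ℝ) (y : A → ℝ) : ∑ a, softmax τ y a = 1 := by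
  unfold softmax
  rw [← Finset.sum_div]
  exact div_self (sum_exp_pos _).ne'

theorem softmax_mem_stdSimplex [Nonempty A] (τ : ℝ) (y : A → ℝ) :
    softmax τ y ∈ stdSimplex ℝ A :=
  ⟨fun a => (softmax_pos τ y a).le, sum_softmax τ y⟩

theorem log_softmax [Nonempty A] (τ : ℝ) (y : A → ℝ) (a : A) :
    Real.log (softmax τ y a) = y a / τ - Real.log (∑ a', Real.exp (y a' / τ)) := by
  unfold softmax
  rw [Real.log_div (Real.exp_pos _).ne' (sum_exp_pos _).ne', Real.log_exp]

theorem shannonEntropy_nonneg {x : A → ℝ} (hx : x ∈ stdSimplex ℝ A) : 0 ≤ shannonEntropy x := by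
  unfold shannonEntropy
  rw [neg_nonneg]
  refine Finset.sum_nonpos fun a _ => mul_nonpos_of_nonneg_of_nonpos (hx.1 a) ?_
  refine Real.log_nonpos (hx.1 a) ?_
  rw [← hx.2]
  exact Finset.single_le_sum (fun b _ => hx.1 b) (Finset.mem_univ a)

/-- Gibbs' variational inequality. -/
theorem dotProduct_add_entropy_le [Nonempty A] {τ : ℝ} (hτ : 0 < τ) (y : A → ℝ) {x : A → ℝ}
    (hx : x ∈ stdSimplex ℝ A) : x ⬝ᵥ y + τ * shannonEntropy x ≤ logSumExp τ y := by
  -- Coordinatewise `log t ≤ t - 1` at `t = softmax τ y a / x a`, multiplied by `x a`; both sides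
  -- sum over the simplex, and the right side sums to zero.
  have key : ∀ a, x a * (y a / τ) - x a * Real.log (x a)
      - x a * Real.log (∑ a', Real.exp (y a' / τ)) ≤ softmax τ y a - x a := by
    intro a
    rcases (hx.1 a).eq_or_lt with h | h
    · rw [← h]; simpa using (softmax_pos τ y a).le
    · have h1 := Real.log_le_sub_one_of_pos (div_pos (softmax_pos τ y a) h)
      rw [Real.log_div (softmax_pos τ y a).ne' h.ne', log_softmax] at h1
      have h2 := mul_le_mul_of_nonneg_left h1 h.le
      have h3 : x a * (softmax τ y a / x a - 1) = softmax τ y a - x a := by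
        field_simp
      rw [h3] at h2
      linarith
  have hs := Finset.sum_le_sum fun a (_ : a ∈ Finset.univ) => key a
  rw [Finset.sum_sub_distrib, Finset.sum_sub_distrib, Finset.sum_sub_distrib, sum_softmax, hx.2,
    ← Finset.sum_mul, hx.2] at hs
  have h4 : ∑ a, x a * (y a / τ) = (x ⬝ᵥ y) / τ := by
    simp only [dotProduct, Finset.sum_div, mul_div_assoc]
  rw [h4] at hs
  unfold shannonEntropy logSumExp
  have h5 : x ⬝ᵥ y = τ * ((x ⬝ᵥ y) / τ) := by field_simp
  rw [h5, ← mul_add]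
  apply mul_le_mul_of_nonneg_left _ hτ.le
  linarith

theorem softmax_dotProduct_add_entropy [Nonempty A] {τ : ℝ} (hτ : 0 < τ) (y : A → ℝ) :
    softmax τ y ⬝ᵥ y + τ * shannonEntropy (softmax τ y) = logSumExp τ y := by
  unfold shannonEntropy logSumExp
  simp only [log_softmax, mul_sub, Finset.sum_sub_distrib, ← Finset.sum_mul, sum_softmax]
  have h4 : ∑ a, softmax τ y a * (y a / τ) = (softmax τ y ⬝ᵥ y) / τ := by
    simp only [dotProduct, Finset.sum_div, mul_div_assoc]
  rw [h4]
  field_simp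
  ring

theorem regularizedBestValue_eq [Nonempty A] {τ : ℝ} (hτ : 0 < τ) (R : Matrix A B ℝ) (p : B → ℝ) :
    regularizedBestValue τ R p = logSumExp τ (R.mulVec p) := by
  refine IsGreatest.csSup_eq ⟨⟨softmax τ (R.mulVec p), softmax_mem_stdSimplex _ _,
    softmax_dotProduct_add_entropy hτ _⟩, ?_⟩
  rintro _ ⟨x, hx, rfl⟩
  exact dotProduct_add_entropy_le hτ _ hx

theorem shannonEntropy_le_log_card [Nonempty A] {x : A → ℝ} (hx : x ∈ stdSimplex ℝ A) :
    shannonEntropy x ≤ Real.log (Fintype.card A) := by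
  have := dotProduct_add_entropy_le one_pos (0 : A → ℝ) hx
  simpa [logSumExp] using this

theorem logSumExp_sub_le_softmax_dotProduct [Nonempty A] {τ : ℝ} (hτ : 0 < τ) (y : A → ℝ) :
    logSumExp τ y - τ * Real.log (Fintype.card A) ≤ softmax τ y ⬝ᵥ y := by
  have h1 := softmax_dotProduct_add_entropy hτ y
  have h2 := mul_le_mul_of_nonneg_left
    (shannonEntropy_le_log_card (softmax_mem_stdSimplex τ y)) hτ.le
  linarith

theorem dotProduct_le_of_mem_stdSimplex {x y : A → ℝ} {D : ℝ} (hx : x ∈ stdSimplex ℝ A)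
    (hy : ∀ a, y a ≤ D) : x ⬝ᵥ y ≤ D := by
  calc x ⬝ᵥ y ≤ ∑ a, x a * D :=
        Finset.sum_le_sum fun a _ => mul_le_mul_of_nonneg_left (hy a) (hx.1 a)
    _ = D := by rw [← Finset.sum_mul, hx.2, one_mul]

theorem logSumExp_le [Nonempty A] {τ : ℝ} (hτ : 0 < τ) {y : A → ℝ} {D : ℝ}
    (hy : ∀ a, y a ≤ D) : logSumExp τ y ≤ D + τ * Real.log (Fintype.card A) := by
  have h1 := logSumExp_sub_le_softmax_dotProduct hτ y
  have h2 := dotProduct_le_of_mem_stdSimplex (softmax_mem_stdSimplex τ y) hy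
  linarith

/-- Smoothness of log-sum-exp with respect to the sup norm. -/
theorem logSumExp_add_le [Nonempty A] {τ : ℝ} (hτ : 0 < τ) (y d : A → ℝ) {D : ℝ}
    (hd : ∀ a, |d a| ≤ D) (hD : D ≤ τ) :
    logSumExp τ (y + d) ≤ logSumExp τ y + softmax τ y ⬝ᵥ d + D ^ 2 / τ := by
  have hZ := sum_exp_pos (fun a => y a / τ)
  have hsum : ∑ a, Real.exp ((y + d) a / τ)
      = (∑ a, Real.exp (y a / τ)) * ∑ a, softmax τ y a * Real.exp (d a / τ) := by
    rw [Finset.mul_sum]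
    refine Finset.sum_congr rfl fun a _ => ?_
    rw [Pi.add_apply, add_div, Real.exp_add]
    unfold softmax
    field_simp
  -- Uses `exp t ≤ 1 + t + t²`, valid for `|t| ≤ 1`; this is where `D ≤ τ` enters.
  have hle : ∑ a, softmax τ y a * Real.exp (d a / τ)
      ≤ 1 + (softmax τ y ⬝ᵥ d) / τ + (D / τ) ^ 2 := by
    calc ∑ a, softmax τ y a * Real.exp (d a / τ)
        ≤ ∑ a, (softmax τ y a + softmax τ y a * d a / τ + softmax τ y a * (D / τ) ^ 2) := by
          refine Finset.sum_le_sum fun a _ => ?_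
          have h1 : |d a / τ| ≤ D / τ := by
            rw [abs_div, abs_of_pos hτ]; exact div_le_div_of_nonneg_right (hd a) hτ.le
          have h2 : |d a / τ| ≤ 1 := h1.trans ((div_le_one hτ).2 hD)
          have h3 := (abs_le.1 (Real.abs_exp_sub_one_sub_id_le h2)).2
          have h4 : (d a / τ) ^ 2 ≤ (D / τ) ^ 2 := by
            rw [← sq_abs]; exact pow_le_pow_left₀ (abs_nonneg _) h1 2
          calc softmax τ y a * Real.exp (d a / τ)
              ≤ softmax τ y a * (1 + d a / τ + (D / τ) ^ 2) :=
                mul_le_mul_of_nonneg_left (by linarith) (softmax_pos τ y a).le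
            _ = _ := by ring
      _ = _ := by
          rw [Finset.sum_add_distrib, Finset.sum_add_distrib, sum_softmax, ← Finset.sum_mul,
            sum_softmax, one_mul, ← Finset.sum_div]
          rfl
  have hpos : 0 < ∑ a, softmax τ y a * Real.exp (d a / τ) :=
    Finset.sum_pos (fun a _ => mul_pos (softmax_pos τ y a) (Real.exp_pos _))
      Finset.univ_nonempty
  unfold logSumExp
  rw [hsum, Real.log_mul hZ.ne' hpos.ne']
  have h5 := Real.log_le_sub_one_of_pos hpos
  have h6 := mul_le_mul_of_nonneg_left (h5.trans (sub_le_sub_right hle 1)) hτ.le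
  have h7 : τ * (1 + (softmax τ y ⬝ᵥ d) / τ + (D / τ) ^ 2 - 1)
      = softmax τ y ⬝ᵥ d + D ^ 2 / τ := by
    field_simp; ring
  rw [h7] at h6
  linarith

theorem sum_abs_sub_le_two {x y : A → ℝ} (hx : x ∈ stdSimplex ℝ A) (hy : y ∈ stdSimplex ℝ A) :
    ∑ a, |x a - y a| ≤ 2 := by
  calc ∑ a, |x a - y a| ≤ ∑ a, (x a + y a) := by
        refine Finset.sum_le_sum fun a _ => abs_le.2 ⟨?_, ?_⟩ <;>
          linarith [hx.1 a, hy.1 a]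
    _ = 2 := by rw [Finset.sum_add_distrib, hx.2, hy.2]; norm_num

/-- Numerator and normaliser each change by a factor of at most `exp (δ / τ)`. -/
theorem softmax_le_exp_mul [Nonempty A] {τ : ℝ} (hτ : 0 < τ) (q y : A → ℝ) {δ : ℝ}
    (h : ∀ a, |q a - y a| ≤ δ) (a : A) :
    softmax τ q a ≤ Real.exp (2 * δ / τ) * softmax τ y a := by
  have hZq := sum_exp_pos (fun a => q a / τ)
  have hZy := sum_exp_pos (fun a => y a / τ)
  have h1 : Real.exp (q a / τ) ≤ Real.exp (δ / τ) * Real.exp (y a / τ) := by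
    rw [← Real.exp_add, ← add_div]
    exact Real.exp_le_exp.2 (div_le_div_of_nonneg_right (by linarith [(abs_le.1 (h a)).2]) hτ.le)
  have h2 : ∑ a, Real.exp (y a / τ) ≤ Real.exp (δ / τ) * ∑ a, Real.exp (q a / τ) := by
    rw [Finset.mul_sum]
    refine Finset.sum_le_sum fun b _ => ?_
    rw [← Real.exp_add, ← add_div]
    exact Real.exp_le_exp.2 (div_le_div_of_nonneg_right (by linarith [(abs_le.1 (h b)).1]) hτ.le)
  unfold softmax
  rw [← mul_div_assoc, div_le_div_iff₀ hZq hZy]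
  have h3 : Real.exp (2 * δ / τ) = Real.exp (δ / τ) * Real.exp (δ / τ) := by
    rw [← Real.exp_add]; ring_nf
  rw [h3]
  calc _ ≤ (Real.exp (δ / τ) * Real.exp (y a / τ)) * (Real.exp (δ / τ) * ∑ a, Real.exp (q a / τ)) :=
        mul_le_mul h1 h2 hZy.le (by positivity)
    _ = _ := by ring

/-- The softmax is Lipschitz from the sup norm to the `ℓ¹` norm. -/
theorem sum_abs_softmax_sub_le [Nonempty A] {τ : ℝ} (hτ : 0 < τ) (q y : A → ℝ) {δ : ℝ}
    (hδ : 0 ≤ δ) (h : ∀ a, |q a - y a| ≤ δ) :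
    ∑ a, |softmax τ q a - softmax τ y a| ≤ 4 * δ / τ := by
  -- Otherwise the claimed bound exceeds 2, the `ℓ¹` diameter of the simplex.
  by_cases hs : 2 * δ / τ ≤ 1
  · have ht : 0 ≤ 2 * δ / τ := by positivity
    have he : Real.exp (2 * δ / τ) ≤ 1 + 2 * (2 * δ / τ) := by
      have := (abs_le.1 (Real.abs_exp_sub_one_sub_id_le
        (show |2 * δ / τ| ≤ 1 by rwa [abs_of_nonneg ht]))).2
      nlinarith
    have h' : ∀ a, |y a - q a| ≤ δ := fun a => by rw [abs_sub_comm]; exact h a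
    have hinv : 1 - 2 * δ / τ ≤ Real.exp (-(2 * δ / τ)) := by
      linarith [Real.add_one_le_exp (-(2 * δ / τ))]
    calc ∑ a, |softmax τ q a - softmax τ y a|
        ≤ ∑ a, softmax τ y a * (2 * (2 * δ / τ)) := by
          refine Finset.sum_le_sum fun a _ => ?_
          have hp := softmax_pos τ y a
          have h1 := softmax_le_exp_mul hτ q y h a
          have h2 := softmax_le_exp_mul hτ y q h' a
          have h3 := mul_le_mul_of_nonneg_right he hp.le
          have h4 : Real.exp (-(2 * δ / τ)) * softmax τ y a ≤ softmax τ q a := by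
            rw [Real.exp_neg, inv_mul_le_iff₀ (Real.exp_pos _)]; exact h2
          have h5 := mul_le_mul_of_nonneg_right hinv hp.le
          have h6 := mul_nonneg ht hp.le
          rw [abs_le]
          constructor <;> nlinarith
      _ = 4 * δ / τ := by rw [← Finset.sum_mul, sum_softmax]; ring
  · have := sum_abs_sub_le_two (softmax_mem_stdSimplex τ q) (softmax_mem_stdSimplex τ y)
    have h2 : 4 * δ / τ = 2 * (2 * δ / τ) := by ring
    rw [h2]
    linarith

end Softmax

/-! ### One-step drift of the two Lyapunov functions. -/

section Drift

variable {A B : Type*} [Fintype A] [Fintype B]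

theorem abs_mulVec_le {R : Matrix A B ℝ} (hR : ∀ a b, |R a b| ≤ 1) (v : B → ℝ) (a : A) :
    |R.mulVec v a| ≤ ∑ b, |v b| := by
  refine (Finset.abs_sum_le_sum_abs _ _).trans (Finset.sum_le_sum fun b _ => ?_)
  rw [abs_mul]
  exact mul_le_of_le_one_left (abs_nonneg _) (hR a b)

theorem abs_mulVec_le_one {R : Matrix A B ℝ} (hR : ∀ a b, |R a b| ≤ 1) {p : B → ℝ}
    (hp : p ∈ stdSimplex ℝ B) (a : A) : |R.mulVec p a| ≤ 1 := by
  refine (abs_mulVec_le hR p a).trans_eq ?_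
  rw [← hp.2]
  exact Finset.sum_congr rfl fun b _ => abs_of_nonneg (hp.1 b)

theorem mulVec_strategyUpdate (R : Matrix A B ℝ) (τ β : ℝ) (p q : B → ℝ) :
    R.mulVec (strategyUpdate τ β p q) = R.mulVec p + β • R.mulVec (softmax τ q - p) := by
  rw [strategyUpdate, Matrix.mulVec_add, Matrix.mulVec_smul]

theorem abs_smul_mulVec_softmax_sub_le [Nonempty B] {R : Matrix A B ℝ} (hR : ∀ a b, |R a b| ≤ 1)
    {p : B → ℝ} (hp : p ∈ stdSimplex ℝ B) {β : ℝ} (hβ : 0 ≤ β) (τ : ℝ) (q : B → ℝ) (a : A) :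
    |(β • R.mulVec (softmax τ q - p)) a| ≤ 2 * β := by
  rw [Pi.smul_apply, smul_eq_mul, abs_mul, abs_of_nonneg hβ, mul_comm]
  exact mul_le_mul_of_nonneg_right ((abs_mulVec_le hR _ a).trans
    (sum_abs_sub_le_two (softmax_mem_stdSimplex τ q) hp)) hβ

theorem logSumExp_mulVec_strategyUpdate_le [Nonempty A] [Nonempty B] {R : Matrix A B ℝ}
    (hR : ∀ a b, |R a b| ≤ 1) {p : B → ℝ} (hp : p ∈ stdSimplex ℝ B) {τ β : ℝ} (hβ : 0 ≤ β)
    (hτ : 0 < τ) (hβτ : 2 * β ≤ τ) (q : B → ℝ) :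
    logSumExp τ (R.mulVec (strategyUpdate τ β p q)) ≤ (1 - β) * logSumExp τ (R.mulVec p)
      + β * (softmax τ (R.mulVec p) ⬝ᵥ R.mulVec (softmax τ q) + τ * Real.log (Fintype.card A))
      + 4 * β ^ 2 / τ := by
  rw [mulVec_strategyUpdate]
  have h1 := logSumExp_add_le hτ (R.mulVec p) (β • R.mulVec (softmax τ q - p))
    (abs_smul_mulVec_softmax_sub_le hR hp hβ τ q) hβτ
  rw [dotProduct_smul, Matrix.mulVec_sub, dotProduct_sub, smul_eq_mul] at h1
  -- The payoff of the smoothed response is the log-sum-exp up to the entropy term; the first-order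
  -- term thus contains `-β` times the log-sum-exp, which is the contraction.
  have h2 := mul_le_mul_of_nonneg_left (logSumExp_sub_le_softmax_dotProduct hτ (R.mulVec p)) hβ
  have h3 : (2 * β) ^ 2 / τ = 4 * β ^ 2 / τ := by ring
  rw [h3] at h1
  rw [Matrix.mulVec_sub]
  linarith

/-- Replacing the estimate `q` of the payoff vector `y` by `y` changes the payoff of a smoothed
best response by at most a multiple of the squared estimation error. -/
theorem dotProduct_mulVec_softmax_le [Nonempty A] [Nonempty B] {R : Matrix A B ℝ}
    (hR : ∀ a b, |R a b| ≤ 1) {x : A → ℝ} (hx : x ∈ stdSimplex ℝ A) {τ κ : ℝ}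
    (hτ : 0 < τ) (hκ : 0 < κ) (q y : B → ℝ) :
    x ⬝ᵥ R.mulVec (softmax τ q) ≤ x ⬝ᵥ R.mulVec (softmax τ y)
      + (κ + 4 / (κ * τ ^ 2) * ∑ b, (q b - y b) ^ 2) := by
  set S := ∑ b, (q b - y b) ^ 2 with hS
  have hS0 : 0 ≤ S := Finset.sum_nonneg fun _ _ => sq_nonneg _
  have h1 := sum_abs_softmax_sub_le hτ q y (Real.sqrt_nonneg S) fun b =>
    Real.abs_le_sqrt (Finset.single_le_sum (f := fun b => (q b - y b) ^ 2)
      (fun _ _ => sq_nonneg _) (Finset.mem_univ b))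
  have h2 : x ⬝ᵥ R.mulVec (softmax τ q - softmax τ y) ≤ 4 * √S / τ :=
    dotProduct_le_of_mem_stdSimplex hx fun a =>
      ((le_abs_self _).trans (abs_mulVec_le hR _ a)).trans h1
  rw [Matrix.mulVec_sub, dotProduct_sub] at h2
  -- AM-GM by completing a square: an error linear in `√S` becomes one linear in `S`, at the price
  -- of the free constant `κ`.
  have h3 : 4 * √S / τ ≤ κ + 4 / (κ * τ ^ 2) * S := by
    have h4 : κ + 4 / (κ * τ ^ 2) * S - 4 * √S / τ = (κ * τ - 2 * √S) ^ 2 / (κ * τ ^ 2) := by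
      conv_lhs => rw [← Real.sq_sqrt hS0]
      rw [Real.sqrt_sq (Real.sqrt_nonneg S)]
      field_simp
      ring
    have h5 : 0 ≤ (κ * τ - 2 * √S) ^ 2 / (κ * τ ^ 2) := by positivity
    linarith
  linarith

/-- Bias and variance of one coordinate, with the target moved by `d`. The probability `p a₀` of an
update cancels the importance weight, leaving the mean step `-α u`; in the second moment one factor
`1 / p a₀ ≤ 1 / m` survives. -/
theorem sum_mul_sq_add_noise_le [DecidableEq A] {R : Matrix A B ℝ} (hR : ∀ a b, |R a b| ≤ 1)
    {p : A → ℝ} {p' : B → ℝ} (hp : p ∈ stdSimplex ℝ A) (hp' : p' ∈ stdSimplex ℝ B) {m α : ℝ}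
    (hm : 0 < m) (hα : 0 < α) (hα1 : α ≤ 1) {q d : A → ℝ} {D : ℝ} {a₀ : A} (hpm : m ≤ p a₀)
    (hq : |q a₀| ≤ 1) (hd : |d a₀| ≤ D) :
    ∑ a, ∑ b, p a * p' b *
      (tdUpdate α p q a (R a b) a₀ - (R.mulVec p' a₀ + d a₀)) ^ 2
      ≤ (1 - α) * (q a₀ - R.mulVec p' a₀) ^ 2 + (2 * D ^ 2 / α + 4 * α ^ 2 / m) := by
  set y := R.mulVec p' a₀ with hy
  set u := q a₀ - y with hu
  set v := u - d a₀ with hv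
  have hpa : 0 < p a₀ := hm.trans_le hpm
  have hY : ∑ b, p' b * R a₀ b = y := by
    rw [hy, Matrix.mulVec, dotProduct]
    exact Finset.sum_congr rfl fun b _ => mul_comm _ _
  have hinner : ∀ a, ∑ b, p a * p' b * (tdUpdate α p q a (R a b) a₀ - (y + d a₀)) ^ 2
      = p a * v ^ 2 + if a = a₀ then
        2 * v * α * (-u) + α ^ 2 / p a₀ * ∑ b, p' b * (R a₀ b - q a₀) ^ 2 else 0 := by
    intro a
    by_cases h : a = a₀
    · subst h
      rw [if_pos rfl]
      have h1 : ∀ b, p a * p' b * (tdUpdate α p q a (R a b) a - (y + d a)) ^ 2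
          = p' b * (p a * v ^ 2) + (2 * v * α) * (p' b * R a b) - p' b * (2 * v * α * q a)
            + α ^ 2 / p a * (p' b * (R a b - q a) ^ 2) := by
        intro b
        have h2 : tdUpdate α p q a (R a b) a - (y + d a) = v + α / p a * (R a b - q a) := by
          simp [tdUpdate, hv, hu]; ring
        rw [h2]
        field_simp
        ring
      rw [Finset.sum_congr rfl fun b _ => h1 b, Finset.sum_add_distrib, Finset.sum_sub_distrib,
        Finset.sum_add_distrib, ← Finset.sum_mul, ← Finset.sum_mul, hp'.2, ← Finset.mul_sum, hY,
        ← Finset.mul_sum, hu]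
      ring
    · rw [if_neg h]
      have h1 : ∀ b, p a * p' b * (tdUpdate α p q a (R a b) a₀ - (y + d a₀)) ^ 2
          = p' b * (p a * v ^ 2) := by
        intro b
        have h2 : tdUpdate α p q a (R a b) a₀ - (y + d a₀) = v := by
          simp [tdUpdate, hv, hu, Ne.symm h]; ring
        rw [h2]; ring
      rw [Finset.sum_congr rfl fun b _ => h1 b, ← Finset.sum_mul, hp'.2]
      ring
  rw [Finset.sum_congr rfl fun a _ => hinner a, Finset.sum_add_distrib, ← Finset.sum_mul, hp.2,
    Finset.sum_ite_eq' Finset.univ a₀, if_pos (Finset.mem_univ _)]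
  have hnoise : ∑ b, p' b * (R a₀ b - q a₀) ^ 2 ≤ 4 := by
    calc ∑ b, p' b * (R a₀ b - q a₀) ^ 2 ≤ ∑ b, p' b * 4 := by
          refine Finset.sum_le_sum fun b _ => mul_le_mul_of_nonneg_left ?_ (hp'.1 b)
          have h1 := abs_le.1 (hR a₀ b)
          have h2 := abs_le.1 hq
          nlinarith
      _ = 4 := by rw [← Finset.sum_mul, hp'.2, one_mul]
  have h3 : α ^ 2 / p a₀ * ∑ b, p' b * (R a₀ b - q a₀) ^ 2 ≤ 4 * α ^ 2 / m := by
    calc _ ≤ α ^ 2 / p a₀ * 4 := mul_le_mul_of_nonneg_left hnoise (by positivity)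
      _ ≤ α ^ 2 / m * 4 := by gcongr
      _ = _ := by ring
  have hdD : (d a₀) ^ 2 ≤ D ^ 2 := by
    rw [← sq_abs]; exact pow_le_pow_left₀ (abs_nonneg _) hd 2
  -- Half of the contraction `2α` is spent on absorbing the cross term with the target's movement
  -- `d`.
  have h4 : v ^ 2 + 2 * v * α * (-u) ≤ (1 - α) * u ^ 2 + 2 * D ^ 2 / α := by
    have h5 : 2 * (d a₀) ^ 2 / α ≤ 2 * D ^ 2 / α := by gcongr
    have h6 : (1 - α) * u ^ 2 + 2 * (d a₀) ^ 2 / α - (v ^ 2 + 2 * v * α * (-u))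
        = ((α * u + (1 - α) * d a₀) ^ 2 + (1 + α * (1 - α)) * (d a₀) ^ 2) / α := by
      rw [hv]; field_simp; ring
    have h7 : 0 ≤ ((α * u + (1 - α) * d a₀) ^ 2 + (1 + α * (1 - α)) * (d a₀) ^ 2) / α := by
      have : 0 ≤ α * (1 - α) := mul_nonneg hα.le (by linarith)
      positivity
    linarith
  linarith

/-- Expected one-step drift of the squared error of the `q`-values of one player. -/
theorem expected_sq_error_tdUpdate_le [DecidableEq A] [Nonempty B] {R : Matrix A B ℝ}
    (hR : ∀ a b, |R a b| ≤ 1)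
    {p : A → ℝ} {p' : B → ℝ} (hp : p ∈ stdSimplex ℝ A) (hp' : p' ∈ stdSimplex ℝ B) {m α β : ℝ}
    (hm : 0 < m) (hα : 0 < α) (hα1 : α ≤ 1) (hβ : 0 ≤ β) (τ : ℝ) {q : A → ℝ} (q' : B → ℝ)
    (hpm : ∀ a, m ≤ p a) (hq : ∀ a, |q a| ≤ 1) :
    ∑ a, ∑ b, p a * p' b * ∑ a₀, (tdUpdate α p q a (R a b) a₀
        - R.mulVec (strategyUpdate τ β p' q') a₀) ^ 2
      ≤ (1 - α) * ∑ a, (q a - R.mulVec p' a) ^ 2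
        + Fintype.card A * (8 * β ^ 2 / α + 4 * α ^ 2 / m) := by
  have hswap : ∑ a, ∑ b, p a * p' b * ∑ a₀, (tdUpdate α p q a (R a b) a₀
        - R.mulVec (strategyUpdate τ β p' q') a₀) ^ 2
      = ∑ a₀, ∑ a, ∑ b, p a * p' b * (tdUpdate α p q a (R a b) a₀
        - R.mulVec (strategyUpdate τ β p' q') a₀) ^ 2 := by
    rw [Finset.sum_comm]
    simp only [Finset.mul_sum]
    rw [Finset.sum_comm, Finset.sum_congr rfl fun a _ => Finset.sum_comm, Finset.sum_comm]
  rw [hswap, mulVec_strategyUpdate]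
  calc _ ≤ ∑ a₀, ((1 - α) * (q a₀ - R.mulVec p' a₀) ^ 2
          + (2 * (2 * β) ^ 2 / α + 4 * α ^ 2 / m)) :=
        Finset.sum_le_sum fun a₀ _ => sum_mul_sq_add_noise_le hR hp hp' hm hα hα1 (hpm a₀) (hq a₀)
          (abs_smul_mulVec_softmax_sub_le hR hp' hβ τ q' a₀)
    _ = _ := by
        rw [Finset.sum_add_distrib, ← Finset.mul_sum, Finset.sum_const, Finset.card_univ,
          nsmul_eq_mul]
        ring

theorem card_le_Amax_left (A B : Type*) [Fintype A] [Fintype B] :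
    Fintype.card A ≤ Amax A B := le_max_left _ _

theorem card_le_Amax_right (A B : Type*) [Fintype A] [Fintype B] :
    Fintype.card B ≤ Amax A B := le_max_right _ _

theorem log_card_le_left (A B : Type*) [Fintype A] [Fintype B] [Nonempty A] :
    Real.log (Fintype.card A) ≤ Real.log (Amax A B) :=
  Real.log_le_log (by exact_mod_cast Fintype.card_pos) (by exact_mod_cast card_le_Amax_left A B)

theorem log_card_le_right (A B : Type*) [Fintype A] [Fintype B] [Nonempty B] :
    Real.log (Fintype.card B) ≤ Real.log (Amax A B) :=
  Real.log_le_log (by exact_mod_cast Fintype.card_pos) (by exact_mod_cast card_le_Amax_right A B)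

namespace ZeroSumGame

theorem R₂_apply (G : ZeroSumGame A B) (a : A) (b : B) : G.R₂ b a = -G.R₁ a b := by
  have := congrFun (congrFun G.zero_sum a) b
  simp only [Matrix.add_apply, Matrix.transpose_apply, Matrix.zero_apply] at this
  linarith

theorem bounded₂ (G : ZeroSumGame A B) (b : B) (a : A) : |G.R₂ b a| ≤ 1 := by
  rw [R₂_apply, abs_neg]; exact G.bounded a b

theorem dotProduct_R₂ (G : ZeroSumGame A B) (x : A → ℝ) (y : B → ℝ) :
    y ⬝ᵥ G.R₂.mulVec x = -(x ⬝ᵥ G.R₁.mulVec y) := by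
  have h : G.R₂ = -G.R₁.transpose := by
    ext b a; simpa using G.R₂_apply a b
  rw [h, Matrix.neg_mulVec, dotProduct_neg, Matrix.mulVec_transpose, dotProduct_comm,
    Matrix.dotProduct_mulVec]

variable [Nonempty A] [Nonempty B]

theorem lyapunovV_eq (G : ZeroSumGame A B) {τ : ℝ} (hτ : 0 < τ) (s : PlayState A B) :
    G.lyapunovV τ s = logSumExp τ (G.R₁.mulVec s.p₂) + logSumExp τ (G.R₂.mulVec s.p₁) := by
  rw [lyapunovV, regularizedBestValue_eq hτ, regularizedBestValue_eq hτ]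

theorem lyapunovW_nonneg (G : ZeroSumGame A B) (s : PlayState A B) : 0 ≤ G.lyapunovW s :=
  add_nonneg (Finset.sum_nonneg fun _ _ => sq_nonneg _)
    (Finset.sum_nonneg fun _ _ => sq_nonneg _)


theorem bestGain_le {τ : ℝ} (hτ : 0 < τ) (R : Matrix A B ℝ) (p : A → ℝ) (p' : B → ℝ) :
    bestGain R p p' ≤ logSumExp τ (R.mulVec p') - p ⬝ᵥ R.mulVec p' := by
  refine csSup_le ((Set.Nonempty.image _ ⟨_, softmax_mem_stdSimplex τ p⟩)) ?_
  rintro _ ⟨x, hx, rfl⟩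
  have h1 := dotProduct_add_entropy_le hτ (R.mulVec p') hx
  have h2 := mul_nonneg hτ.le (shannonEntropy_nonneg hx)
  simp only [sub_dotProduct]
  linarith

/-- Nonnegativity of the entropy bounds each gain by a log-sum-exp minus the realised payoff, and
the realised payoffs sum to zero. -/
theorem nashGap_le_lyapunovV (G : ZeroSumGame A B) {τ : ℝ} (hτ : 0 < τ) (s : PlayState A B) :
    G.nashGap s.p₁ s.p₂ ≤ G.lyapunovV τ s := by
  have h1 := bestGain_le hτ G.R₁ s.p₁ s.p₂
  have h2 := bestGain_le hτ G.R₂ s.p₂ s.p₁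
  rw [dotProduct_R₂] at h2
  rw [lyapunovV_eq G hτ, nashGap]
  linarith

variable [DecidableEq A] [DecidableEq B]

/-- One-step drift of the Lyapunov function of the strategies. -/
theorem lyapunovV_step_le (G : ZeroSumGame A B) {τ β κ : ℝ} (c : ℝ) (hτ : 0 < τ) (hβ : 0 ≤ β)
    (hβτ : 2 * β ≤ τ) (hκ : 0 < κ) {s : PlayState A B} (hp₁ : s.p₁ ∈ stdSimplex ℝ A)
    (hp₂ : s.p₂ ∈ stdSimplex ℝ B) (a : A × B) :
    G.lyapunovV τ (G.step τ c β s a) ≤ (1 - β) * G.lyapunovV τ s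
      + β * (2 * τ * Real.log (Amax A B) + 2 * κ + 4 / (κ * τ ^ 2) * G.lyapunovW s)
      + 8 * β ^ 2 / τ := by
  rw [lyapunovV_eq G hτ, lyapunovV_eq G hτ]
  have h1 := logSumExp_mulVec_strategyUpdate_le G.bounded hp₂ hβ hτ hβτ s.q₂
  have h2 := logSumExp_mulVec_strategyUpdate_le G.bounded₂ hp₁ hβ hτ hβτ s.q₁
  have h3 := dotProduct_mulVec_softmax_le G.bounded
    (softmax_mem_stdSimplex τ (G.R₁.mulVec s.p₂)) hτ hκ s.q₂ (G.R₂.mulVec s.p₁)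
  have h4 := dotProduct_mulVec_softmax_le G.bounded₂
    (softmax_mem_stdSimplex τ (G.R₂.mulVec s.p₁)) hτ hκ s.q₁ (G.R₁.mulVec s.p₂)
  -- With exact payoff vectors the two smoothed responses face each other, so their payoffs cancel.
  have h5 := G.dotProduct_R₂ (softmax τ (G.R₁.mulVec s.p₂)) (softmax τ (G.R₂.mulVec s.p₁))
  have h6 := mul_le_mul_of_nonneg_left (log_card_le_left A B) hτ.le
  have h7 := mul_le_mul_of_nonneg_left (log_card_le_right A B) hτ.le
  have h8 : softmax τ (G.R₁.mulVec s.p₂) ⬝ᵥ G.R₁.mulVec (softmax τ s.q₂)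
        + τ * Real.log (Fintype.card A)
      + (softmax τ (G.R₂.mulVec s.p₁) ⬝ᵥ G.R₂.mulVec (softmax τ s.q₁)
        + τ * Real.log (Fintype.card B))
      ≤ 2 * τ * Real.log (Amax A B) + 2 * κ + 4 / (κ * τ ^ 2) * G.lyapunovW s := by
    rw [lyapunovW, mul_add]
    linarith
  have h9 := mul_le_mul_of_nonneg_left h8 hβ
  have h10 : 8 * β ^ 2 / τ = 4 * β ^ 2 / τ + 4 * β ^ 2 / τ := by ring
  rw [h10]
  simp only [step]
  linarith

/-- Expected one-step drift of the Lyapunov function of the `q`-values. -/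
theorem expected_lyapunovW_step_le (G : ZeroSumGame A B) {c β m : ℝ} (τ : ℝ) (hc : 0 < c)
    (hβ : 0 < β) (hβc : β / c ≤ 1) (hm : 0 < m) {s : PlayState A B} (hp₁ : s.p₁ ∈ stdSimplex ℝ A)
    (hp₂ : s.p₂ ∈ stdSimplex ℝ B) (hm₁ : ∀ a, m ≤ s.p₁ a) (hm₂ : ∀ b, m ≤ s.p₂ b)
    (hq₁ : ∀ a, |s.q₁ a| ≤ 1) (hq₂ : ∀ b, |s.q₂ b| ≤ 1) :
    ∑ a : A × B, s.p₁ a.1 * s.p₂ a.2 * G.lyapunovW (G.step τ c β s a)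
      ≤ (1 - β / c) * G.lyapunovW s
        + 2 * Amax A B * (8 * β * c + 4 * (β / c) ^ 2 / m) := by
  have hα : 0 < β / c := div_pos hβ hc
  have h1 := expected_sq_error_tdUpdate_le G.bounded hp₁ hp₂ hm hα hβc hβ.le τ s.q₂ hm₁ hq₁
  have h2 := expected_sq_error_tdUpdate_le G.bounded₂ hp₂ hp₁ hm hα hβc hβ.le τ s.q₁ hm₂ hq₂
  rw [Finset.sum_comm] at h2
  have hr : 8 * β ^ 2 / (β / c) = 8 * β * c := by field_simp
  rw [hr] at h1 h2
  have hn : 0 ≤ 8 * β * c + 4 * (β / c) ^ 2 / m := by positivity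
  have hA : (Fintype.card A : ℝ) ≤ Amax A B := by exact_mod_cast card_le_Amax_left A B
  have hB : (Fintype.card B : ℝ) ≤ Amax A B := by exact_mod_cast card_le_Amax_right A B
  have h3 := mul_le_mul_of_nonneg_right hA hn
  have h4 := mul_le_mul_of_nonneg_right hB hn
  have hsplit : ∑ a : A × B, s.p₁ a.1 * s.p₂ a.2 * G.lyapunovW (G.step τ c β s a)
      = (∑ a, ∑ b, s.p₁ a * s.p₂ b * ∑ a₀, (tdUpdate (β / c) s.p₁ s.q₁ a (G.R₁ a b) a₀
          - G.R₁.mulVec (strategyUpdate τ β s.p₂ s.q₂) a₀) ^ 2)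
        + ∑ a, ∑ b, s.p₂ b * s.p₁ a * ∑ b₀, (tdUpdate (β / c) s.p₂ s.q₂ b (G.R₂ b a) b₀
          - G.R₂.mulVec (strategyUpdate τ β s.p₁ s.q₁) b₀) ^ 2 := by
    rw [Fintype.sum_prod_type, ← Finset.sum_add_distrib]
    refine Finset.sum_congr rfl fun a _ => ?_
    rw [← Finset.sum_add_distrib]
    refine Finset.sum_congr rfl fun b _ => ?_
    simp only [lyapunovW, step]
    ring
  rw [hsplit, lyapunovW, mul_add]
  linarith

end ZeroSumGame

end Drift

/-! ### Invariants along a history and the recursion in expectation. -/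

/-- The mixed strategies give probability at least `m` to every action and the `q`-values lie in
`[-1, 1]`. -/
structure PlayState.IsControlled {A B : Type*} [Fintype A] [Fintype B] (m : ℝ)
    (s : PlayState A B) : Prop where
  p₁_mem : s.p₁ ∈ stdSimplex ℝ A
  p₂_mem : s.p₂ ∈ stdSimplex ℝ B
  le_p₁ : ∀ a, m ≤ s.p₁ a
  le_p₂ : ∀ b, m ≤ s.p₂ b
  q₁_le : ∀ a, |s.q₁ a| ≤ 1
  q₂_le : ∀ b, |s.q₂ b| ≤ 1

/-- The product of the contraction factors `1 - β j` of the rounds `1, …, k`. -/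
noncomputable def decayProd (β : ℕ → ℝ) (k : ℕ) : ℝ := ∏ j ∈ Finset.range k, (1 - β (j + 1))

section Recursion

variable {A B : Type*} [Fintype A] [Fintype B]

theorem decayProd_zero (β : ℕ → ℝ) : decayProd β 0 = 1 := Finset.prod_range_zero _

theorem decayProd_succ (β : ℕ → ℝ) (k : ℕ) :
    decayProd β (k + 1) = decayProd β k * (1 - β (k + 1)) := Finset.prod_range_succ _ _

theorem strategyUpdate_mem_stdSimplex [Nonempty A] {β : ℝ} (hβ : 0 ≤ β) (hβ1 : β ≤ 1) (τ : ℝ)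
    {p : A → ℝ} (hp : p ∈ stdSimplex ℝ A) (q : A → ℝ) :
    strategyUpdate τ β p q ∈ stdSimplex ℝ A := by
  have h := convex_stdSimplex ℝ A hp (softmax_mem_stdSimplex τ q) (sub_nonneg.2 hβ1) hβ
    (sub_add_cancel 1 β)
  convert h using 1
  rw [strategyUpdate, smul_sub, sub_smul, one_smul]
  abel

theorem le_strategyUpdate [Nonempty A] {β m : ℝ} (hβ : 0 ≤ β) (hβ1 : β ≤ 1) (τ : ℝ)
    {p : A → ℝ} {a : A} (hp : m ≤ p a) (q : A → ℝ) :
    m * (1 - β) ≤ strategyUpdate τ β p q a := by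
  simp only [strategyUpdate, Pi.add_apply, Pi.smul_apply, Pi.sub_apply, smul_eq_mul]
  have h1 := mul_nonneg hβ (softmax_pos τ q a).le
  have h2 := mul_le_mul_of_nonneg_right hp (sub_nonneg.2 hβ1)
  linarith

/-- When `α ≤ p a` the new entry is a convex combination of the old entry and the payoff. -/
theorem abs_tdUpdate_le_one [DecidableEq A] {α r : ℝ} {p q : A → ℝ} {a : A} (hα : 0 ≤ α)
    (hp : 0 < p a) (hαp : α ≤ p a) (hr : |r| ≤ 1) (hq : ∀ a, |q a| ≤ 1) (a' : A) :
    |tdUpdate α p q a r a'| ≤ 1 := by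
  by_cases h : a' = a
  · subst h
    have h1 : tdUpdate α p q a' r a' = (1 - α / p a') * q a' + α / p a' * r := by
      simp [tdUpdate]; ring
    have h2 : 0 ≤ α / p a' := div_nonneg hα hp.le
    have h3 : 0 ≤ 1 - α / p a' := sub_nonneg.2 ((div_le_one hp).2 hαp)
    rw [h1]
    have h4 := abs_le.1 hr
    have h5 := abs_le.1 (hq a')
    rw [abs_le]
    constructor <;> nlinarith
  · have h1 : tdUpdate α p q a r a' = q a' := by simp [tdUpdate, h]
    rw [h1]
    exact hq a'

variable [Nonempty A] [Nonempty B]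

theorem isControlled_initialState :
    (initialState A B).IsControlled (1 / (Amax A B : ℝ)) := by
  have hA : (0 : ℝ) < Fintype.card A := by exact_mod_cast Fintype.card_pos
  have hB : (0 : ℝ) < Fintype.card B := by exact_mod_cast Fintype.card_pos
  have hA' : (Fintype.card A : ℝ) ≤ Amax A B := by exact_mod_cast card_le_Amax_left A B
  have hB' : (Fintype.card B : ℝ) ≤ Amax A B := by exact_mod_cast card_le_Amax_right A B
  refine ⟨⟨fun a => ?_, ?_⟩, ⟨fun a => ?_, ?_⟩, fun a => ?_, fun b => ?_, fun a => ?_, fun b => ?_⟩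
  · exact (one_div_pos.2 hA).le
  · simp [initialState, hA.ne']
  · exact (one_div_pos.2 hB).le
  · simp [initialState, hB.ne']
  · exact one_div_le_one_div_of_le hA hA'
  · exact one_div_le_one_div_of_le hB hB'
  · simp [initialState]
  · simp [initialState]

namespace ZeroSumGame

variable [DecidableEq A] [DecidableEq B]

/-- The expectation of `f` of the state after `K` rounds. -/
noncomputable def historyExp (G : ZeroSumGame A B) (τ c : ℝ) (β : ℕ → ℝ) (K : ℕ)
    (f : PlayState A B → ℝ) : ℝ :=
  ∑ h : Fin K → A × B, G.historyProb τ c β K h * f (G.stateAfter τ c β K h)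

theorem historyExp_zero (G : ZeroSumGame A B) (τ c : ℝ) (β : ℕ → ℝ) (f : PlayState A B → ℝ) :
    G.historyExp τ c β 0 f = f (initialState A B) := by
  simp [historyExp, historyProb, stateAfter]

/-- The tower rule: conditioning on all but the last round. -/
theorem historyExp_succ (G : ZeroSumGame A B) (τ c : ℝ) (β : ℕ → ℝ) (K : ℕ)
    (f : PlayState A B → ℝ) :
    G.historyExp τ c β (K + 1) f = G.historyExp τ c β K
      fun s => ∑ a : A × B, s.p₁ a.1 * s.p₂ a.2 * f (G.step τ c (β (K + 1)) s a) := by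
  unfold historyExp
  rw [← (Fin.snocEquiv fun _ : Fin (K + 1) => A × B).sum_comp, Fintype.sum_prod_type_right]
  refine Finset.sum_congr rfl fun h _ => ?_
  rw [Finset.mul_sum]
  refine Finset.sum_congr rfl fun a _ => ?_
  simp [Fin.snocEquiv, historyProb, stateAfter, mul_assoc]

theorem isControlled_step (G : ZeroSumGame A B) {c β m : ℝ} (τ : ℝ) (hc : 0 < c) (hβ : 0 ≤ β)
    (hβ1 : β ≤ 1) (hm : 0 < m) (hβm : β / c ≤ m) {s : PlayState A B} (hs : s.IsControlled m)
    (a : A × B) : (G.step τ c β s a).IsControlled (m * (1 - β)) where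
  p₁_mem := strategyUpdate_mem_stdSimplex hβ hβ1 τ hs.p₁_mem _
  p₂_mem := strategyUpdate_mem_stdSimplex hβ hβ1 τ hs.p₂_mem _
  le_p₁ a' := le_strategyUpdate hβ hβ1 τ (hs.le_p₁ a') _
  le_p₂ b' := le_strategyUpdate hβ hβ1 τ (hs.le_p₂ b') _
  q₁_le := abs_tdUpdate_le_one (div_nonneg hβ hc.le) (hm.trans_le (hs.le_p₁ _))
    (hβm.trans (hs.le_p₁ _)) (G.bounded _ _) hs.q₁_le
  q₂_le := abs_tdUpdate_le_one (div_nonneg hβ hc.le) (hm.trans_le (hs.le_p₂ _))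
    (hβm.trans (hs.le_p₂ _)) (G.bounded₂ _ _) hs.q₂_le

section Horizon

variable (G : ZeroSumGame A B) {τ c κ b ρ : ℝ} {β : ℕ → ℝ} {K : ℕ}

/-- The lower bound on the probabilities loses a factor `1 - β` per round; over the horizon it stays
above `ρ / A_max`, which `hbc` makes large enough to keep the TD steps convex combinations. -/
theorem isControlled_stateAfter (τ : ℝ) (hc : 0 < c) (hb : b < 1) (hρ : 0 < ρ)
    (hβ : ∀ k < K, 0 < β (k + 1) ∧ β (k + 1) ≤ b) (hP : ∀ k < K, ρ ≤ decayProd β k)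
    (hbc : b / c ≤ ρ / Amax A B) {k : ℕ} (hk : k ≤ K) (h : Fin k → A × B) :
    (G.stateAfter τ c β k h).IsControlled (decayProd β k / Amax A B) := by
  have hM : (0 : ℝ) < Amax A B := by
    exact_mod_cast Fintype.card_pos.trans_le (card_le_Amax_left A B)
  induction k with
  | zero => rw [decayProd_zero]; exact isControlled_initialState
  | succ k ih =>
    have hβk := hβ k hk
    have hPk := div_le_div_of_nonneg_right (hP k hk) hM.le
    rw [decayProd_succ, mul_div_right_comm]
    exact G.isControlled_step τ hc hβk.1.le (hβk.2.trans hb.le)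
      ((div_pos hρ hM).trans_le hPk)
      (((div_le_div_of_nonneg_right hβk.2 hc.le).trans hbc).trans hPk)
      (ih (Nat.le_of_succ_le hk) _) _

theorem historyProb_nonneg (hc : 0 < c) (hb : b < 1) (hρ : 0 < ρ)
    (hβ : ∀ k < K, 0 < β (k + 1) ∧ β (k + 1) ≤ b) (hP : ∀ k < K, ρ ≤ decayProd β k)
    (hbc : b / c ≤ ρ / Amax A B) {k : ℕ} (hk : k ≤ K) (h : Fin k → A × B) :
    0 ≤ G.historyProb τ c β k h := by
  induction k with
  | zero => exact zero_le_one
  | succ k ih =>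
    have hs := G.isControlled_stateAfter τ hc hb hρ hβ hP hbc (Nat.le_of_succ_le hk)
      fun j => h j.castSucc
    exact mul_nonneg (ih (Nat.le_of_succ_le hk) _)
      (mul_nonneg (hs.p₁_mem.1 _) (hs.p₂_mem.1 _))

theorem sum_p₁_mul_p₂ {m : ℝ} {s : PlayState A B} (hs : s.IsControlled m) :
    ∑ a : A × B, s.p₁ a.1 * s.p₂ a.2 = 1 := by
  rw [Fintype.sum_prod_type]
  simp only [← Finset.mul_sum, hs.p₂_mem.2, hs.p₁_mem.2, mul_one]

/-- A one-step drift inequality on controlled states gives a drift inequality in expectation. -/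
theorem historyExp_succ_le (hc : 0 < c) (hb : b < 1) (hρ : 0 < ρ)
    (hβ : ∀ k < K, 0 < β (k + 1) ∧ β (k + 1) ≤ b) (hP : ∀ k < K, ρ ≤ decayProd β k)
    (hbc : b / c ≤ ρ / Amax A B) {k : ℕ} (hk : k < K) {f g : PlayState A B → ℝ}
    (hfg : ∀ s : PlayState A B, s.IsControlled (ρ / Amax A B) →
      ∑ a : A × B, s.p₁ a.1 * s.p₂ a.2 * f (G.step τ c (β (k + 1)) s a) ≤ g s) :
    G.historyExp τ c β (k + 1) f ≤ G.historyExp τ c β k g := by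
  rw [historyExp_succ]
  refine Finset.sum_le_sum fun h _ => mul_le_mul_of_nonneg_left (hfg _ ?_)
    (G.historyProb_nonneg hc hb hρ hβ hP hbc hk.le h)
  have hs := G.isControlled_stateAfter τ hc hb hρ hβ hP hbc hk.le h
  have hle : ρ / Amax A B ≤ decayProd β k / Amax A B :=
    div_le_div_of_nonneg_right (hP k hk) (Nat.cast_nonneg _)
  exact ⟨hs.p₁_mem, hs.p₂_mem, fun a => hle.trans (hs.le_p₁ a), fun a => hle.trans (hs.le_p₂ a),
    hs.q₁_le, hs.q₂_le⟩

theorem historyExp_one (hc : 0 < c) (hb : b < 1) (hρ : 0 < ρ)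
    (hβ : ∀ k < K, 0 < β (k + 1) ∧ β (k + 1) ≤ b) (hP : ∀ k < K, ρ ≤ decayProd β k)
    (hbc : b / c ≤ ρ / Amax A B) {k : ℕ} (hk : k ≤ K) :
    G.historyExp τ c β k (fun _ => 1) = 1 := by
  induction k with
  | zero => exact G.historyExp_zero τ c β _
  | succ k ih =>
    rw [historyExp_succ]
    refine Eq.trans ?_ (ih (Nat.le_of_succ_le hk))
    refine Finset.sum_congr rfl fun h _ => ?_
    simp only [mul_one]
    rw [sum_p₁_mul_p₂
      (G.isControlled_stateAfter τ hc hb hρ hβ hP hbc (Nat.le_of_succ_le hk) h), mul_one]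

/-- One-step drift of the combined Lyapunov function `V + W / A_max` at a controlled state. -/
theorem expected_lyapunov_step_le {x : ℝ} (hτ : 0 < τ) (hc : 0 < c) (hκ : 0 < κ) (hρ : 0 < ρ)
    (hx : 0 < x) (hxb : x ≤ b) (hbτ : 2 * b ≤ τ)
    (hcκ : c * (4 * Amax A B / (κ * τ ^ 2) + 1) ≤ 1)
    (hbc : b / c ≤ ρ / Amax A B) {s : PlayState A B} (hs : s.IsControlled (ρ / Amax A B)) :
    ∑ a : A × B, s.p₁ a.1 * s.p₂ a.2 * (G.lyapunovV τ (G.step τ c x s a)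
        + G.lyapunovW (G.step τ c x s a) / Amax A B)
      ≤ (1 - x) * (G.lyapunovV τ s + G.lyapunovW s / Amax A B)
        + x * (2 * τ * Real.log (Amax A B) + 2 * κ + 8 * b / τ + 16 * c
          + 8 * b / c ^ 2 * (Amax A B / ρ)) := by
  have hM : (0 : ℝ) < Amax A B := by
    exact_mod_cast Fintype.card_pos.trans_le (card_le_Amax_left A B)
  have hsum := sum_p₁_mul_p₂ hs
  have hm1 : ρ / Amax A B ≤ 1 := by
    obtain ⟨a⟩ := ‹Nonempty A›
    refine (hs.le_p₁ a).trans ?_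
    rw [← hs.p₁_mem.2]
    exact Finset.single_le_sum (fun b _ => hs.p₁_mem.1 b) (Finset.mem_univ a)
  have hxc : x / c ≤ 1 := ((div_le_div_of_nonneg_right hxb hc.le).trans hbc).trans hm1
  have hW := G.expected_lyapunovW_step_le τ hc hx hxc (div_pos hρ hM) hs.p₁_mem hs.p₂_mem
    hs.le_p₁ hs.le_p₂ hs.q₁_le hs.q₂_le
  have hV : ∑ a : A × B, s.p₁ a.1 * s.p₂ a.2 * G.lyapunovV τ (G.step τ c x s a)
      ≤ (1 - x) * G.lyapunovV τ s
        + x * (2 * τ * Real.log (Amax A B) + 2 * κ + 4 / (κ * τ ^ 2) * G.lyapunovW s)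
        + 8 * x ^ 2 / τ := by
    refine (Finset.sum_le_sum fun a _ => mul_le_mul_of_nonneg_left
      (G.lyapunovV_step_le c hτ hx.le (by linarith) hκ hs.p₁_mem hs.p₂_mem a)
      (mul_nonneg (hs.p₁_mem.1 _) (hs.p₂_mem.1 _))).trans_eq ?_
    rw [← Finset.sum_mul, hsum, one_mul]
  have hW' := div_le_div_of_nonneg_right hW hM.le
  have hsplit : ∑ a : A × B, s.p₁ a.1 * s.p₂ a.2 * (G.lyapunovV τ (G.step τ c x s a)
        + G.lyapunovW (G.step τ c x s a) / Amax A B)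
      = (∑ a : A × B, s.p₁ a.1 * s.p₂ a.2 * G.lyapunovV τ (G.step τ c x s a))
        + (∑ a : A × B, s.p₁ a.1 * s.p₂ a.2 * G.lyapunovW (G.step τ c x s a)) / Amax A B := by
    rw [Finset.sum_div, ← Finset.sum_add_distrib]
    exact Finset.sum_congr rfl fun a _ => by ring
  rw [hsplit]
  have hW0 := G.lyapunovW_nonneg s
  have e1 : ((1 - x / c) * G.lyapunovW s
        + 2 * Amax A B * (8 * x * c + 4 * (x / c) ^ 2 / (ρ / Amax A B))) / Amax A B
      = (1 - x / c) * G.lyapunovW s / Amax A B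
        + x * (16 * c) + x * (8 * x / c ^ 2 * (Amax A B / ρ)) := by
    field_simp
    ring
  rw [e1] at hW'
  have e2 : 8 * x / c ^ 2 * (Amax A B / ρ) ≤ 8 * b / c ^ 2 * (Amax A B / ρ) := by gcongr
  have e3 : 8 * x ^ 2 / τ ≤ x * (8 * b / τ) := by
    have : 8 * x ^ 2 / τ = x * (8 * x / τ) := by ring
    rw [this]
    gcongr
  have e4 := mul_le_mul_of_nonneg_left e2 hx.le
  -- The surplus of the rate `x / c` over `x` absorbs the cost of `W` in the drift of `V`; `hcκ`
  -- says precisely that it suffices.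
  have e5 : x * (4 / (κ * τ ^ 2) * G.lyapunovW s) + (1 - x / c) * G.lyapunovW s / Amax A B
      ≤ (1 - x) * (G.lyapunovW s / Amax A B) := by
    have h1 : (1 - x) * (G.lyapunovW s / Amax A B)
        - (x * (4 / (κ * τ ^ 2) * G.lyapunovW s) + (1 - x / c) * G.lyapunovW s / Amax A B)
        = x / c * (G.lyapunovW s / Amax A B)
          * (1 - c * (4 * Amax A B / (κ * τ ^ 2) + 1)) := by
      field_simp
      ring
    have h2 : 0 ≤ x / c * (G.lyapunovW s / Amax A B)
          * (1 - c * (4 * Amax A B / (κ * τ ^ 2) + 1)) :=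
      mul_nonneg (by positivity) (by linarith)
    linarith
  linarith

/-- Finite-horizon bound for the expected Nash gap. -/
theorem expectedNashGap_le (hτ : 0 < τ) (hc : 0 < c) (hκ : 0 < κ) (hb0 : 0 ≤ b) (hb : b < 1)
    (hρ : 0 < ρ) (hβ : ∀ k < K, 0 < β (k + 1) ∧ β (k + 1) ≤ b)
    (hP : ∀ k < K, ρ ≤ decayProd β k) (hbτ : 2 * b ≤ τ)
    (hcκ : c * (4 * Amax A B / (κ * τ ^ 2) + 1) ≤ 1) (hbc : b / c ≤ ρ / Amax A B) :
    G.expectedNashGap τ c β K ≤ decayProd β K * (G.lyapunovV τ (initialState A B)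
        + G.lyapunovW (initialState A B) / Amax A B)
      + (2 * τ * Real.log (Amax A B) + 2 * κ + 8 * b / τ + 16 * c
          + 8 * b / c ^ 2 * (Amax A B / ρ)) := by
  have hM : (1 : ℝ) ≤ Amax A B := by
    exact_mod_cast (Nat.succ_le_of_lt Fintype.card_pos).trans (card_le_Amax_left A B)
  set E := 2 * τ * Real.log (Amax A B) + 2 * κ + 8 * b / τ + 16 * c
          + 8 * b / c ^ 2 * (Amax A B / ρ) with hE
  have hE0 : 0 ≤ E := by
    have := Real.log_nonneg hM
    positivity
  set L : PlayState A B → ℝ := fun s => G.lyapunovV τ s + G.lyapunovW s / Amax A B with hL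
  have hrec : ∀ k ≤ K, G.historyExp τ c β k L ≤ decayProd β k * L (initialState A B) + E := by
    intro k hk
    induction k with
    | zero =>
      rw [historyExp_zero, decayProd_zero]
      linarith
    | succ k ih =>
      have hβk := hβ k hk
      have h1 := G.historyExp_succ_le (τ := τ) hc hb hρ hβ hP hbc hk (f := L)
        (g := fun s => (1 - β (k + 1)) * L s + β (k + 1) * E) fun s hs =>
          G.expected_lyapunov_step_le hτ hc hκ hρ hβk.1 hβk.2 hbτ hcκ hbc hs
      have h2 : G.historyExp τ c β k (fun s => (1 - β (k + 1)) * L s + β (k + 1) * E)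
          = (1 - β (k + 1)) * G.historyExp τ c β k L + β (k + 1) * E := by
        have h3 := G.historyExp_one (τ := τ) hc hb hρ hβ hP hbc (Nat.le_of_succ_le hk)
        unfold historyExp at h3 ⊢
        simp only [mul_one] at h3
        simp only [mul_add, Finset.sum_add_distrib]
        rw [← Finset.sum_mul, h3, one_mul, Finset.mul_sum]
        exact congrArg (· + _) (Finset.sum_congr rfl fun h _ => by ring)
      rw [h2] at h1
      have h4 := mul_le_mul_of_nonneg_left (ih (Nat.le_of_succ_le hk))
        (by linarith [hβk.2] : 0 ≤ 1 - β (k + 1))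
      rw [decayProd_succ]
      linarith
  refine le_trans ?_ (hrec K le_rfl)
  refine Finset.sum_le_sum fun h _ => mul_le_mul_of_nonneg_left ?_
    (G.historyProb_nonneg hc hb hρ hβ hP hbc le_rfl h)
  have h1 := G.nashGap_le_lyapunovV hτ (G.stateAfter τ c β K h)
  have h2 := div_nonneg (G.lyapunovW_nonneg (G.stateAfter τ c β K h)) (Nat.cast_nonneg (Amax A B))
  exact h1.trans (le_add_of_nonneg_right h2)

end Horizon

end ZeroSumGame

end Recursion

/-! ### Choice of the parameters. -/

section Parameters

/-- One bound on `β` implies every smallness condition needed, each with smaller exponents and a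
smaller constant. -/
theorem pow_div_le_pow_div {ε s : ℝ} (hε : 0 < ε) (hε1 : ε ≤ 1) (hs : 1 ≤ s) {i j : ℕ}
    (hi : i ≤ 8) (hj : j ≤ 20) {N : ℝ} (hN : 0 < N) (hN' : N ≤ 10 ^ 16) :
    ε ^ 8 / (10 ^ 16 * s ^ 20) ≤ ε ^ i / (N * s ^ j) := by
  have hs0 : 0 < s := by linarith
  apply div_le_div₀ (by positivity) (pow_le_pow_of_le_one hε.le hε1 hi) (by positivity)
  exact mul_le_mul hN' (pow_le_pow_right₀ hs hj) (by positivity) (by positivity)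

/-- The parameter choices make all error terms small. -/
theorem parameter_bounds {M ε τ c β : ℝ} (hM : 2 ≤ M) (hε : 0 < ε) (hε1 : ε < 1)
    (hτ : τ = ε / (12 * Real.log M)) (hc : c = 1 / 8 * τ ^ 3 / (6 * M ^ 2))
    (hβ : 0 < β) (hβ' : β ≤ ε ^ 8 / (10 ^ 16 * M ^ 10)) :
    0 < τ ∧ 2 * τ * Real.log M ≤ 1 / 6 * ε ∧ 0 < c ∧ c < 1 ∧ β < 1 ∧ 2 * β ≤ τ ∧
      c * (4 * M / (ε / 48 * τ ^ 2) + 1) ≤ 1 ∧ β / c ≤ ε / (36 * M) / M ∧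
      β * (2 + 12 * M / ε) ≤ 1 ∧
      2 * τ * Real.log M + 2 * (ε / 48) + 8 * β / τ + 16 * c
        + 8 * β / c ^ 2 * (M / (ε / (36 * M))) ≤ 2 / 3 * ε := by
  -- Working with `s = √M` gives `log M ≤ 2s`, so a logarithm costs only half a power of `M`. The
  -- noise term then needs `s ^ 18`, within `s ^ 20 = M ^ 10`; the cruder `log M ≤ M` would exceed
  -- this.
  obtain ⟨s, hs0, hsM⟩ : ∃ s : ℝ, 0 < s ∧ M = s ^ 2 :=
    ⟨√M, Real.sqrt_pos.2 (by linarith), (Real.sq_sqrt (by linarith)).symm⟩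
  have hs : 1 ≤ s := by nlinarith
  have hlog2 : 2 / 3 ≤ Real.log M :=
    le_trans (by linarith [Real.log_two_gt_d9]) (Real.log_le_log two_pos hM)
  have hlog : Real.log M ≤ 2 * s := by
    rw [hsM, Real.log_pow]
    have := Real.log_le_sub_one_of_pos hs0
    push_cast
    linarith
  have hlog0 : 0 < Real.log M := by linarith
  have hτ0 : 0 < τ := by rw [hτ]; positivity
  have hτ1 : τ ≤ ε / 8 := by
    rw [hτ]; exact div_le_div_of_nonneg_left hε.le (by norm_num) (by linarith)
  have hτ2 : ε / (24 * s) ≤ τ := by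
    rw [hτ]; exact div_le_div_of_nonneg_left hε.le (by positivity) (by linarith)
  have hτM : 2 * τ * Real.log M = 1 / 6 * ε := by
    rw [hτ]; field_simp; norm_num
  have hc0 : 0 < c := by rw [hc]; positivity
  have hc1 : 16 * c ≤ ε / 24 := by
    have h1 : 16 * c = τ ^ 3 / (3 * M ^ 2) := by rw [hc]; field_simp; norm_num
    have h2 : τ ^ 3 ≤ ε / 8 := by
      calc τ ^ 3 ≤ τ ^ 1 := pow_le_pow_of_le_one hτ0.le (by linarith) (by norm_num)
        _ ≤ ε / 8 := by rwa [pow_one]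
    have h3 : 4 ≤ M ^ 2 := by nlinarith
    rw [h1, div_le_iff₀ (by positivity)]
    linarith [mul_le_mul_of_nonneg_left h3 hε.le]
  have hc2 : ε ^ 3 / (663552 * s ^ 7) ≤ c := by
    calc ε ^ 3 / (663552 * s ^ 7) = 1 / 8 * (ε / (24 * s)) ^ 3 / (6 * (s ^ 2) ^ 2) := by
          field_simp; norm_num
      _ ≤ c := by rw [hc, hsM]; gcongr
  have hb : ∀ {i j : ℕ} {N : ℝ}, i ≤ 8 → j ≤ 20 → 0 < N → N ≤ 10 ^ 16 →
      β ≤ ε ^ i / (N * s ^ j) := by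
    intro i j N hi hj hN hN'
    refine le_trans ?_ (pow_div_le_pow_div hε hε1.le hs hi hj hN hN')
    rw [hsM, ← pow_mul] at hβ'
    exact hβ'
  have hβτ : 8 * β / τ ≤ ε / 24 := by
    rw [div_le_iff₀ hτ0]
    have h1 := hb (i := 2) (j := 1) (N := 4608) (by norm_num) (by norm_num) (by norm_num)
      (by norm_num)
    have h2 : ε ^ 2 / (4608 * s ^ 1) = ε / 192 * (ε / (24 * s)) := by field_simp; norm_num
    have h3 := mul_le_mul_of_nonneg_left hτ2 (by positivity : 0 ≤ ε / 192)
    linarith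
  have hβ1 : β ≤ 1 / 4 := by
    have := hb (i := 0) (j := 0) (N := 4) (by norm_num) (by norm_num) (by norm_num) (by norm_num)
    simpa using this
  -- The binding condition: it dictates `ε ^ 8`, and its constant `6912 * 663552 ^ 2` is the reason
  -- for `10 ^ 16`.
  have hnoise : 8 * β / c ^ 2 * (M / (ε / (36 * M))) ≤ ε / 24 := by
    have h1 := hb (i := 8) (j := 18) (N := 6912 * 663552 ^ 2) (by norm_num) (by norm_num)
      (by norm_num) (by norm_num)
    have h2 : ε ^ 8 / (6912 * 663552 ^ 2 * s ^ 18)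
        = ε ^ 2 / (6912 * s ^ 4) * (ε ^ 3 / (663552 * s ^ 7)) ^ 2 := by
      field_simp
    have h3 : ε ^ 2 / (6912 * s ^ 4) * (ε ^ 3 / (663552 * s ^ 7)) ^ 2
        ≤ ε ^ 2 / (6912 * s ^ 4) * c ^ 2 := by gcongr
    have h4 : 8 * β / c ^ 2 * (M / (ε / (36 * M))) = β * (288 * s ^ 4 / (ε * c ^ 2)) := by
      rw [hsM]; field_simp; norm_num
    rw [h4]
    calc β * (288 * s ^ 4 / (ε * c ^ 2))
        ≤ (ε ^ 2 / (6912 * s ^ 4) * c ^ 2) * (288 * s ^ 4 / (ε * c ^ 2)) := by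
          gcongr; linarith
      _ = ε / 24 := by field_simp; norm_num
  refine ⟨hτ0, hτM.le, hc0, by linarith, by linarith, ?_, ?_, ?_, ?_, by linarith⟩
  · rw [div_le_iff₀ hτ0] at hβτ
    nlinarith
  · have h1 : c * (4 * M / (ε / 48 * τ ^ 2)) = 4 * τ / (ε * M) := by
      rw [hc]; field_simp; norm_num
    rw [mul_add, h1, mul_one]
    have h2 : 4 * τ / (ε * M) ≤ 1 / 4 := by
      rw [div_le_iff₀ (by positivity)]
      nlinarith
    linarith
  · rw [div_le_iff₀ hc0]
    have h1 := hb (i := 4) (j := 11) (N := 36 * 663552) (by norm_num) (by norm_num)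
      (by norm_num) (by norm_num)
    have h2 : ε ^ 4 / (36 * 663552 * s ^ 11)
        = ε / (36 * M) / M * (ε ^ 3 / (663552 * s ^ 7)) := by
      rw [hsM]; field_simp
    have h3 := mul_le_mul_of_nonneg_left hc2 (by positivity : 0 ≤ ε / (36 * M) / M)
    linarith
  · have h1 := hb (i := 1) (j := 2) (N := 24) (by norm_num) (by norm_num) (by norm_num)
      (by norm_num)
    rw [← hsM, le_div_iff₀ (by positivity)] at h1
    have h2 : β * (12 * M / ε) ≤ 1 / 2 := by
      rw [← mul_div_assoc, div_le_iff₀ hε]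
      linarith
    linarith

end Parameters

/-! ### Numbers of rounds and decay of the product of contraction factors. -/

section Rounds

theorem roundsConst_spec {T ε β : ℝ} (hT : 0 < T) (hε : 0 < ε) (hβ : 0 < β) (hβ1 : β < 1) :
    decayProd (fun _ => β) (roundsConst T ε 1 β) ≤ ε / (3 * T) ∧
      ∀ k < roundsConst T ε 1 β, ε / (3 * T) ≤ decayProd (fun _ => β) k := by
  have h1 : 0 < 1 - β := by linarith
  have hlog : Real.log (1 - β) < 0 := Real.log_neg h1 (by linarith)
  have hx : 0 < ε / (3 * T) := by positivity
  have hd : ∀ k, decayProd (fun _ => β) k = (1 - β) ^ k := fun k => by simp [decayProd]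
  unfold roundsConst
  rw [one_mul]
  constructor
  · rw [hd, ← Real.log_le_log_iff (by positivity) hx, Real.log_pow]
    exact (div_le_iff_of_neg hlog).1 (Nat.le_ceil _)
  · intro k hk
    rw [hd, ← Real.log_le_log_iff hx (by positivity), Real.log_pow]
    exact ((lt_div_iff_of_neg hlog).1 (Nat.lt_ceil.1 hk)).le

theorem roundsConst_le {T ε β : ℝ} (hε : 0 < ε) (hεT : ε ≤ 3 * T) (hβ : 0 < β)
    (hβ1 : β < 1) : (roundsConst T ε 1 β : ℝ) ≤ Real.log (3 * T / ε) / β + 1 := by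
  have h1 : 0 < 1 - β := by linarith
  have hlog : Real.log (1 - β) ≤ -β := by linarith [Real.log_le_sub_one_of_pos h1]
  have hl : 0 ≤ Real.log (3 * T / ε) := Real.log_nonneg ((one_le_div hε).2 hεT)
  have h2 : Real.log (ε / (3 * T)) / Real.log (1 - 1 * β) ≤ Real.log (3 * T / ε) / β := by
    rw [one_mul, ← inv_div (3 * T), Real.log_inv, neg_div, ← div_neg]
    exact div_le_div_of_nonneg_left hl hβ (by linarith)
  have h3 : 0 ≤ Real.log (ε / (3 * T)) / Real.log (1 - 1 * β) := by
    rw [one_mul, ← inv_div (3 * T), Real.log_inv, neg_div, ← div_neg]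
    exact div_nonneg hl (by linarith)
  exact (Nat.ceil_lt_add_one h3).le.trans (by linarith)

/-- Bernoulli's inequality; with the next lemma it replaces comparing the sum of `x ^ (-η)` with an
integral. -/
theorem rpow_add_one_sub_rpow_le {x η : ℝ} (hx : 0 < x) (hη : 0 ≤ η) (hη1 : η ≤ 1) :
    (x + 1) ^ (1 - η) - x ^ (1 - η) ≤ (1 - η) / x ^ η := by
  have h1 := rpow_one_add_le_one_add_mul_self (s := 1 / x) (p := 1 - η)
    (by linarith [one_div_pos.2 hx]) (by linarith) (by linarith)
  have h2 : x + 1 = x * (1 + 1 / x) := by field_simp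
  have h3 : x ^ (1 - η) = x / x ^ η := by rw [Real.rpow_sub hx, Real.rpow_one]
  have h4 : 0 < x ^ η := Real.rpow_pos_of_pos hx _
  rw [h2, Real.mul_rpow hx.le (by positivity), h3]
  have h5 := mul_le_mul_of_nonneg_left h1 (by positivity : 0 ≤ x / x ^ η)
  have h6 : x / x ^ η * (1 + (1 - η) * (1 / x)) = x / x ^ η + (1 - η) / x ^ η := by
    field_simp
  linarith

theorem le_rpow_sub_rpow_sub_one {x η : ℝ} (hx : 1 ≤ x) (hη : 0 ≤ η) (hη1 : η ≤ 1) :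
    (1 - η) / x ^ η ≤ x ^ (1 - η) - (x - 1) ^ (1 - η) := by
  have hx0 : 0 < x := by linarith
  have hinv : 1 / x ≤ 1 := (div_le_one hx0).2 hx
  have h1 := rpow_one_add_le_one_add_mul_self (s := -(1 / x)) (p := 1 - η)
    (by linarith) (by linarith) (by linarith)
  have h2 : x - 1 = x * (1 + -(1 / x)) := by field_simp; ring
  have h3 : x ^ (1 - η) = x / x ^ η := by rw [Real.rpow_sub hx0, Real.rpow_one]
  have h4 : 0 < x ^ η := Real.rpow_pos_of_pos hx0 _
  rw [h2, Real.mul_rpow hx0.le (by linarith), h3]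
  have h5 := mul_le_mul_of_nonneg_left h1 (by positivity : 0 ≤ x / x ^ η)
  have h6 : x / x ^ η * (1 + (1 - η) * -(1 / x)) = x / x ^ η - (1 - η) / x ^ η := by
    field_simp
    ring
  linarith

section Poly

variable {β k₀ η : ℝ}

theorem polyStep_pos (hβ : 0 < β) (hk₀ : 0 ≤ k₀) (k : ℕ) : 0 < polyStep β k₀ η (k + 1) := by
  unfold polyStep
  push_cast
  positivity

theorem polyStep_le (hβ : 0 < β) (hk₀ : 0 ≤ k₀) (hη : 0 ≤ η) (k : ℕ) :
    polyStep β k₀ η (k + 1) ≤ β := by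
  unfold polyStep
  push_cast
  exact div_le_self hβ.le (Real.one_le_rpow (by linarith [Nat.cast_nonneg (α := ℝ) k]) hη)

theorem le_sum_polyStep (hβ : 0 < β) (hk₀ : 0 ≤ k₀) (hη : 0 < η) (hη1 : η < 1) (n : ℕ) :
    β / (1 - η) * ((n + 1 + k₀) ^ (1 - η) - (1 + k₀) ^ (1 - η))
      ≤ ∑ j ∈ Finset.range n, polyStep β k₀ η (j + 1) := by
  have hη' : 0 < 1 - η := by linarith
  induction n with
  | zero => simp
  | succ n ih =>
    rw [Finset.sum_range_succ]
    have h1 := rpow_add_one_sub_rpow_le (x := n + 1 + k₀) (by positivity) hη.le hη1.le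
    have h2 := mul_le_mul_of_nonneg_left h1 (by positivity : 0 ≤ β / (1 - η))
    have h3 : β / (1 - η) * ((1 - η) / (n + 1 + k₀) ^ η) = polyStep β k₀ η (n + 1) := by
      unfold polyStep; push_cast; field_simp
    rw [h3] at h2
    have h4 : ((n + 1 : ℕ) : ℝ) + 1 + k₀ = n + 1 + k₀ + 1 := by push_cast; ring
    rw [h4]
    linarith

theorem sum_polyStep_le (hβ : 0 < β) (hk₀ : 0 ≤ k₀) (hη : 0 < η) (hη1 : η < 1) (n : ℕ) :
    ∑ j ∈ Finset.range (n + 1), polyStep β k₀ η (j + 1)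
      ≤ β + β / (1 - η) * ((n + 1 + k₀) ^ (1 - η) - (1 + k₀) ^ (1 - η)) := by
  have hη' : 0 < 1 - η := by linarith
  induction n with
  -- The first step size is bounded by `β` on its own, which accounts for the extra `β`; the others
  -- telescope.
  | zero => simpa using polyStep_le hβ hk₀ hη.le 0
  | succ n ih =>
    rw [Finset.sum_range_succ]
    have h1 := le_rpow_sub_rpow_sub_one (x := (n + 1 : ℕ) + 1 + k₀)
      (by linarith [Nat.cast_nonneg (α := ℝ) (n + 1)]) hη.le hη1.le
    have h2 := mul_le_mul_of_nonneg_left h1 (by positivity : 0 ≤ β / (1 - η))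
    have h3 : β / (1 - η) * ((1 - η) / ((n + 1 : ℕ) + 1 + k₀) ^ η)
        = polyStep β k₀ η (n + 1 + 1) := by
      unfold polyStep; push_cast; field_simp
    rw [h3] at h2
    have h4 : ((n + 1 : ℕ) : ℝ) + 1 + k₀ - 1 = n + 1 + k₀ := by push_cast; ring
    rw [h4] at h2
    linarith

theorem decayProd_le_exp {β : ℕ → ℝ} {K : ℕ} (hβ : ∀ k < K, β (k + 1) ≤ 1) :
    decayProd β K ≤ Real.exp (-∑ j ∈ Finset.range K, β (j + 1)) := by
  rw [← Finset.sum_neg_distrib, Real.exp_sum]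
  refine Finset.prod_le_prod (fun j hj => sub_nonneg.2 (hβ j (Finset.mem_range.1 hj)))
    fun j _ => ?_
  linarith [Real.add_one_le_exp (-β (j + 1))]

/-- From `log (1 - x) ≥ -x / (1 - x)`. -/
theorem exp_le_decayProd {β : ℕ → ℝ} {K : ℕ} {b : ℝ} (hb : b < 1)
    (hβ : ∀ k < K, 0 ≤ β (k + 1) ∧ β (k + 1) ≤ b) :
    Real.exp (-((∑ j ∈ Finset.range K, β (j + 1)) / (1 - b))) ≤ decayProd β K := by
  rw [Finset.sum_div, ← Finset.sum_neg_distrib, Real.exp_sum]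
  refine Finset.prod_le_prod (fun _ _ => (Real.exp_pos _).le) fun j hj => ?_
  have hj' := hβ j (Finset.mem_range.1 hj)
  have h1 : 0 < 1 - β (j + 1) := by linarith
  have h2 := Real.one_sub_inv_le_log_of_pos h1
  have h3 : β (j + 1) / (1 - β (j + 1)) ≤ β (j + 1) / (1 - b) :=
    div_le_div_of_nonneg_left hj'.1 (by linarith) (by linarith)
  have h4 : 1 - (1 - β (j + 1))⁻¹ = -(β (j + 1) / (1 - β (j + 1))) := by field_simp; ring
  rw [← Real.le_log_iff_exp_le h1]
  linarith

/-- The number of rounds is where the integral bound for the sum of step sizes reaches `l`. Earlier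
sums are at most `β + l`, so the product cannot have dropped much below `exp (-l)`. -/
theorem roundsPoly_spec {T ε N : ℝ} (hT : 0 < T) (hε : 0 < ε) (hTN : 3 * T ≤ N) (hεN : ε ≤ N)
    (hβ : 0 < β) (hβN : β * (2 + N / ε) ≤ 1) (hk₀ : 0 ≤ k₀) (hη : 0 < η) (hη1 : η < 1) :
    decayProd (polyStep β k₀ η) (roundsPoly T ε 1 β k₀ η) ≤ ε / (3 * T) ∧
      ∀ k < roundsPoly T ε 1 β k₀ η, ε / (3 * N) ≤ decayProd (polyStep β k₀ η) k := by
  have hη' : 0 < 1 - η := by linarith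
  have hN : 0 < N := by linarith
  have hNε : 1 ≤ N / ε := (one_le_div hε).2 hεN
  have hβ1 : β < 1 := by nlinarith
  set l := max 0 (Real.log (3 * T / ε)) with hl
  have hl0 : 0 ≤ l := le_max_left _ _
  have hlN : l ≤ Real.log (N / ε) :=
    max_le (Real.log_nonneg hNε)
      (Real.log_le_log (by positivity) (div_le_div_of_nonneg_right hTN hε.le))
  set Y := 1 / 1 * ((1 - η) / β) * l + (1 + k₀) ^ (1 - η) with hY
  have hY0 : 0 ≤ Y := by positivity
  set X := Y ^ (1 / (1 - η)) with hX
  have hXY : X ^ (1 - η) = Y := by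
    rw [hX, ← Real.rpow_mul hY0, one_div_mul_cancel hη'.ne', Real.rpow_one]
  have hX0 : 0 ≤ X := Real.rpow_nonneg hY0 _
  have hφ : β / (1 - η) * (Y - (1 + k₀) ^ (1 - η)) = l := by
    rw [hY]; field_simp; ring
  have hK : roundsPoly T ε 1 β k₀ η = ⌈X - k₀ - 1⌉₊ := rfl
  rw [hK]
  constructor
  · refine (decayProd_le_exp fun k _ => (polyStep_le hβ hk₀ hη.le k).trans hβ1.le).trans ?_
    have h1 := le_sum_polyStep hβ hk₀ hη hη1 ⌈X - k₀ - 1⌉₊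
    have h2 : X ^ (1 - η) ≤ ((⌈X - k₀ - 1⌉₊ : ℝ) + 1 + k₀) ^ (1 - η) :=
      Real.rpow_le_rpow hX0 (by linarith [Nat.le_ceil (X - k₀ - 1)]) hη'.le
    rw [hXY] at h2
    have h3 := mul_le_mul_of_nonneg_left (sub_le_sub_right h2 ((1 + k₀) ^ (1 - η)))
      (by positivity : 0 ≤ β / (1 - η))
    rw [hφ] at h3
    have h4 : Real.log (3 * T / ε) ≤ l := le_max_right _ _
    rw [← Real.exp_log (show 0 < ε / (3 * T) by positivity), ← inv_div (3 * T), Real.log_inv]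
    exact Real.exp_le_exp.2 (by linarith)
  · intro k hk
    refine le_trans ?_ (exp_le_decayProd hβ1 fun j _ =>
      ⟨(polyStep_pos hβ hk₀ j).le, polyStep_le hβ hk₀ hη.le j⟩)
    have hsum : ∑ j ∈ Finset.range k, polyStep β k₀ η (j + 1) ≤ β + l := by
      cases k with
      | zero => simp; linarith
      | succ n =>
        refine (sum_polyStep_le hβ hk₀ hη hη1 n).trans ?_
        have h1 := Nat.lt_ceil.1 hk
        push_cast at h1
        have h2 : ((n : ℝ) + 1 + k₀) ^ (1 - η) ≤ X ^ (1 - η) :=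
          Real.rpow_le_rpow (by positivity) (by linarith) hη'.le
        rw [hXY] at h2
        have h3 := mul_le_mul_of_nonneg_left (sub_le_sub_right h2 ((1 + k₀) ^ (1 - η)))
          (by positivity : 0 ≤ β / (1 - η))
        rw [hφ] at h3
        linarith
    -- `hβN` absorbs both the extra `β` and the factor `1 / (1 - β)` into an additive 1, which
    -- becomes the factor 3 through `e < 3`.
    have hle : (∑ j ∈ Finset.range k, polyStep β k₀ η (j + 1)) / (1 - β)
        ≤ Real.log (N / ε) + 1 := by
      rw [div_le_iff₀ (by linarith)]
      have h1 : Real.log (N / ε) ≤ N / ε := by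
        linarith [Real.log_le_sub_one_of_pos (show 0 < N / ε by positivity)]
      nlinarith
    calc ε / (3 * N) ≤ Real.exp (-(Real.log (N / ε) + 1)) := by
          rw [Real.exp_neg, Real.exp_add, Real.exp_log (by positivity)]
          have h1 := Real.exp_one_lt_d9
          have h2 : ε / (3 * N) = (N / ε * 3)⁻¹ := by field_simp
          rw [h2]
          apply inv_anti₀ (by positivity)
          gcongr
          linarith
      _ ≤ _ := Real.exp_le_exp.2 (neg_le_neg hle)

theorem roundsPoly_le {T ε D : ℝ} {n : ℕ} (hβ : 0 < β) (hβ1 : β < 1) (hη : 0 < η) (hη1 : η < 1)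
    (hn : n = ⌈(2 * η / β) ^ (1 / (1 - η))⌉₊) (hD : max 0 (Real.log (3 * T / ε)) ≤ D) :
    (roundsPoly T ε 1 β n η : ℝ) ≤ ((D + 6) / β) ^ (1 / (1 - η)) := by
  have hη' : 0 < 1 - η := by linarith
  have hl0 : 0 ≤ max 0 (Real.log (3 * T / ε)) := le_max_left _ _
  set l := max 0 (Real.log (3 * T / ε)) with hl
  set a := (2 / β) ^ (1 / (1 - η)) with ha
  have h2β : 1 ≤ 2 / β := (one_le_div hβ).2 (by linarith)
  have ha1 : 1 ≤ a := Real.one_le_rpow h2β (by positivity)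
  have haη : a ^ (1 - η) = 2 / β := by
    rw [ha, ← Real.rpow_mul (by positivity), one_div_mul_cancel hη'.ne', Real.rpow_one]
  have hna : (n : ℝ) ≤ a + 1 := by
    rw [hn]
    refine (Nat.ceil_lt_add_one (by positivity)).le.trans ?_
    have : (2 * η / β) ^ (1 / (1 - η)) ≤ a := by
      apply Real.rpow_le_rpow (by positivity) _ (by positivity)
      gcongr
      linarith
    linarith
  -- Here `1 + n ≤ a + 2 ≤ 3a`, and `3 ^ (1 - η) ≤ 3`.
  have h1n : (1 + (n : ℝ)) ^ (1 - η) ≤ 6 / β := by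
    calc (1 + (n : ℝ)) ^ (1 - η) ≤ (3 * a) ^ (1 - η) :=
          Real.rpow_le_rpow (by positivity) (by linarith) hη'.le
      _ = 3 ^ (1 - η) * (2 / β) := by rw [Real.mul_rpow (by norm_num) (by linarith), haη]
      _ ≤ 3 ^ (1 : ℝ) * (2 / β) := by
          gcongr
          · norm_num
          · linarith
      _ = 6 / β := by rw [Real.rpow_one]; ring
  have hY : 1 / 1 * ((1 - η) / β) * l + (1 + (n : ℝ)) ^ (1 - η) ≤ (D + 6) / β := by
    have : 1 / 1 * ((1 - η) / β) * l ≤ D / β := by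
      rw [div_one, one_mul, div_mul_eq_mul_div]
      gcongr
      nlinarith
    rw [add_div]
    linarith
  have hX : (1 / 1 * ((1 - η) / β) * l + (1 + (n : ℝ)) ^ (1 - η)) ^ (1 / (1 - η))
      ≤ ((D + 6) / β) ^ (1 / (1 - η)) :=
    Real.rpow_le_rpow (by positivity) hY (by positivity)
  have hD0 : 0 ≤ ((D + 6) / β) ^ (1 / (1 - η)) := Real.rpow_nonneg (by
    have : 0 ≤ D := hl0.trans hD
    positivity) _
  unfold roundsPoly
  rcases le_or_gt ((1 / 1 * ((1 - η) / β) * l + (1 + (n : ℝ)) ^ (1 - η)) ^ (1 / (1 - η))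
    - n - 1) 0 with h | h
  · rw [Nat.ceil_eq_zero.2 h]
    simpa using hD0
  · refine (Nat.ceil_lt_add_one h.le).le.trans ?_
    linarith [Nat.cast_nonneg (α := ℝ) n]

end Poly

end Rounds

/-! ### Initial values and assembly of the theorem. -/

theorem shannonEntropy_uniform {A : Type*} [Fintype A] [Nonempty A] :
    shannonEntropy (fun _ : A => 1 / (Fintype.card A : ℝ)) = Real.log (Fintype.card A) := by
  have : (Fintype.card A : ℝ) ≠ 0 := by exact_mod_cast Fintype.card_ne_zero
  simp [shannonEntropy, this]

namespace ZeroSumGame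

variable {A B : Type*} [Fintype A] [Fintype B] [Nonempty A] [Nonempty B]

theorem initialState_p₁_mem : (initialState A B).p₁ ∈ stdSimplex ℝ A :=
  (isControlled_initialState (A := A) (B := B)).p₁_mem

theorem initialState_p₂_mem : (initialState A B).p₂ ∈ stdSimplex ℝ B :=
  (isControlled_initialState (A := A) (B := B)).p₂_mem

/-- Testing both maxima with the uniform strategies, the payoffs cancel and the two entropies
remain. -/
theorem lyapunovV_initialState_pos (G : ZeroSumGame A B) {τ : ℝ} (hτ : 0 < τ)
    (hM : 2 ≤ Amax A B) : 0 < G.lyapunovV τ (initialState A B) := by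
  have h1 := dotProduct_add_entropy_le hτ (G.R₁.mulVec (initialState A B).p₂)
    (initialState_p₁_mem (B := B))
  have h2 := dotProduct_add_entropy_le hτ (G.R₂.mulVec (initialState A B).p₁)
    (initialState_p₂_mem (A := A))
  have h3 : shannonEntropy (initialState A B).p₁ = Real.log (Fintype.card A) :=
    shannonEntropy_uniform (A := A)
  have h4 : shannonEntropy (initialState A B).p₂ = Real.log (Fintype.card B) :=
    shannonEntropy_uniform (A := B)
  rw [dotProduct_R₂] at h2
  rw [h3] at h1
  rw [h4] at h2
  rw [lyapunovV_eq G hτ]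
  have hA : 0 ≤ Real.log (Fintype.card A) := Real.log_natCast_nonneg _
  have hB : 0 ≤ Real.log (Fintype.card B) := Real.log_natCast_nonneg _
  have hAB : 0 < Real.log (Fintype.card A) + Real.log (Fintype.card B) := by
    rcases le_max_iff.1 (show 2 ≤ max (Fintype.card A) (Fintype.card B) from hM) with h | h
    · linarith [Real.log_pos (show (1 : ℝ) < Fintype.card A by exact_mod_cast h)]
    · linarith [Real.log_pos (show (1 : ℝ) < Fintype.card B by exact_mod_cast h)]
  have := mul_pos hτ hAB
  linarith

theorem lyapunovV_initialState_le (G : ZeroSumGame A B) {τ : ℝ} (hτ : 0 < τ) :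
    G.lyapunovV τ (initialState A B) ≤ 2 + 2 * τ * Real.log (Amax A B) := by
  have h1 := logSumExp_le hτ fun a =>
    (abs_le.1 (abs_mulVec_le_one G.bounded (initialState_p₂_mem (A := A)) a)).2
  have h2 := logSumExp_le hτ fun a =>
    (abs_le.1 (abs_mulVec_le_one G.bounded₂ (initialState_p₁_mem (B := B)) a)).2
  have h6 := mul_le_mul_of_nonneg_left (log_card_le_left A B) hτ.le
  have h7 := mul_le_mul_of_nonneg_left (log_card_le_right A B) hτ.le
  rw [lyapunovV_eq G hτ]
  linarith

theorem sum_sq_mulVec_le_card {R : Matrix A B ℝ} (hR : ∀ a b, |R a b| ≤ 1) {p : B → ℝ}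
    (hp : p ∈ stdSimplex ℝ B) : ∑ a, (0 - R.mulVec p a) ^ 2 ≤ (Fintype.card A : ℝ) := by
  calc ∑ a, (0 - R.mulVec p a) ^ 2 ≤ ∑ _a : A, (1 : ℝ) := by
        refine Finset.sum_le_sum fun a _ => ?_
        rw [zero_sub, neg_sq, sq_le_one_iff_abs_le_one]
        exact abs_mulVec_le_one hR hp a
    _ = _ := by simp

theorem lyapunovW_initialState_le (G : ZeroSumGame A B) :
    G.lyapunovW (initialState A B) ≤ 2 * Amax A B := by
  have h1 := sum_sq_mulVec_le_card G.bounded (initialState_p₂_mem (A := A))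
  have h2 := sum_sq_mulVec_le_card G.bounded₂ (initialState_p₁_mem (B := B))
  have hA : (Fintype.card A : ℝ) ≤ Amax A B := by exact_mod_cast card_le_Amax_left A B
  have hB : (Fintype.card B : ℝ) ≤ Amax A B := by exact_mod_cast card_le_Amax_right A B
  have h3 : G.lyapunovW (initialState A B)
      = ∑ a, (0 - G.R₁.mulVec (initialState A B).p₂ a) ^ 2
        + ∑ b, (0 - G.R₂.mulVec (initialState A B).p₁ b) ^ 2 := rfl
  linarith

variable [DecidableEq A] [DecidableEq B]

/-- The expected Nash gap is small once the initial value has decayed, as long as the products of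
the contraction factors stay polynomially large until then. -/
theorem expectedNashGap_le_of_decayProd (G : ZeroSumGame A B) {τ c ε b T : ℝ} {β : ℕ → ℝ} {K : ℕ}
    (hM : 2 ≤ Amax A B) (hε : 0 < ε) (hε1 : ε < 1)
    (hτ : τ = ε / (12 * Real.log (Amax A B))) (hc : c = 1 / 8 * τ ^ 3 / (6 * (Amax A B : ℝ) ^ 2))
    (hb : 0 < b) (hb' : b ≤ ε ^ 8 / (10 ^ 16 * (Amax A B : ℝ) ^ 10)) (hT : 0 < T)
    (hLT : G.lyapunovV τ (initialState A B) + G.lyapunovW (initialState A B) / Amax A B ≤ T)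
    (hβ : ∀ k, 0 < β (k + 1) ∧ β (k + 1) ≤ b)
    (hK : decayProd β K ≤ ε / (3 * T))
    (hP : ∀ k < K, ε / (36 * Amax A B) ≤ decayProd β k) :
    G.expectedNashGap τ c β K ≤ ε := by
  have hM' : (2 : ℝ) ≤ Amax A B := by exact_mod_cast hM
  obtain ⟨hτ0, -, hc0, -, hb1, hbτ, hcκ, hbc, -, herr⟩ :=
    parameter_bounds hM' hε hε1 hτ hc hb hb'
  have h1 := G.expectedNashGap_le hτ0 hc0 (by positivity : 0 < ε / 48) hb.le hb1
    (by positivity : 0 < ε / (36 * (Amax A B : ℝ))) (fun k _ => hβ k) hP hbτ hcκ hbc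
  have h0 : 0 ≤ decayProd β K := Finset.prod_nonneg fun j _ => by linarith [(hβ j).2]
  have h2 := mul_le_mul_of_nonneg_left hLT h0
  -- The decayed initial value takes `ε / 3`, the steady error at most `2ε / 3`.
  have h3 := mul_le_mul_of_nonneg_right hK hT.le
  have h4 : ε / (3 * T) * T = 1 / 3 * ε := by field_simp
  linarith

theorem expectedNashGap_const_le (G : ZeroSumGame A B) {τ c ε β T : ℝ}
    (hM : 2 ≤ Amax A B) (hε : 0 < ε) (hε1 : ε < 1)
    (hτ : τ = ε / (12 * Real.log (Amax A B))) (hc : c = 1 / 8 * τ ^ 3 / (6 * (Amax A B : ℝ) ^ 2))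
    (hβ : 0 < β) (hβ' : β ≤ ε ^ 8 / (10 ^ 16 * (Amax A B : ℝ) ^ 10)) (hT : 0 < T)
    (hTM : T ≤ 4 * Amax A B)
    (hLT : G.lyapunovV τ (initialState A B) + G.lyapunovW (initialState A B) / Amax A B ≤ T) :
    G.expectedNashGap τ c (fun _ => β) (roundsConst T ε 1 β) ≤ ε := by
  have hM' : (2 : ℝ) ≤ Amax A B := by exact_mod_cast hM
  obtain ⟨-, -, -, -, hβ1, -⟩ := parameter_bounds hM' hε hε1 hτ hc hβ hβ'
  obtain ⟨h1, h2⟩ := roundsConst_spec hT hε hβ hβ1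
  refine G.expectedNashGap_le_of_decayProd hM hε hε1 hτ hc hβ hβ' hT hLT
    (fun _ => ⟨hβ, le_rfl⟩) h1 fun k hk => le_trans ?_ (h2 k hk)
  exact div_le_div_of_nonneg_left hε.le (by positivity) (by linarith)

theorem expectedNashGap_poly_le (G : ZeroSumGame A B) {τ c ε β T k₀ η : ℝ}
    (hM : 2 ≤ Amax A B) (hε : 0 < ε) (hε1 : ε < 1)
    (hτ : τ = ε / (12 * Real.log (Amax A B))) (hc : c = 1 / 8 * τ ^ 3 / (6 * (Amax A B : ℝ) ^ 2))
    (hβ : 0 < β) (hβ' : β ≤ ε ^ 8 / (10 ^ 16 * (Amax A B : ℝ) ^ 10)) (hT : 0 < T)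
    (hTM : T ≤ 4 * Amax A B)
    (hLT : G.lyapunovV τ (initialState A B) + G.lyapunovW (initialState A B) / Amax A B ≤ T)
    (hk₀ : 0 ≤ k₀) (hη : 0 < η) (hη1 : η < 1) :
    G.expectedNashGap τ c (polyStep β k₀ η) (roundsPoly T ε 1 β k₀ η) ≤ ε := by
  have hM' : (2 : ℝ) ≤ Amax A B := by exact_mod_cast hM
  obtain ⟨-, -, -, -, -, -, -, -, hβN, -⟩ := parameter_bounds hM' hε hε1 hτ hc hβ hβ'
  obtain ⟨h1, h2⟩ := roundsPoly_spec (N := 12 * Amax A B) hT hε (by linarith) (by linarith)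
    hβ hβN hk₀ hη hη1
  refine G.expectedNashGap_le_of_decayProd hM hε hε1 hτ hc hβ hβ' hT hLT
    (fun k => ⟨polyStep_pos hβ hk₀ k, polyStep_le hβ hk₀ hη.le k⟩) h1
    fun k hk => le_of_eq_of_le ?_ (h2 k hk)
  ring

theorem exists_isIterationComplexity_le (G : ZeroSumGame A B) {τ c ε : ℝ} {β : ℕ → ℝ} {k : ℕ}
    (h : G.expectedNashGap τ c β k ≤ ε) :
    ∃ K : ℕ, G.IsIterationComplexity τ c β ε K ∧ K ≤ k := by
  classical
  exact ⟨Nat.find ⟨k, h⟩, ⟨Nat.find_spec ⟨k, h⟩, fun _ hj => Nat.find_min' _ hj⟩,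
    Nat.find_min' _ h⟩

end ZeroSumGame

theorem log_fifteen_div_le {ε : ℝ} (hε : 0 < ε) :
    Real.log (3 * 5 / ε) ≤ 3 + Real.log (1 / ε) := by
  have h1 : Real.log 15 ≤ 3 := by
    rw [Real.log_le_iff_le_exp (by norm_num)]
    have h2 := Real.exp_one_gt_d9
    have h3 : Real.exp 3 = Real.exp 1 ^ 3 := by rw [← Real.exp_nat_mul]; norm_num
    rw [h3]
    calc (15 : ℝ) ≤ 2.7 ^ 3 := by norm_num
      _ ≤ Real.exp 1 ^ 3 := by gcongr; linarith
  have h4 : 3 * 5 / ε = 15 * (1 / ε) := by ring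
  rw [h4, Real.log_mul (by norm_num) (by positivity)]
  linarith

theorem theorem2 :
    ∃ (c₁ c₂ c₃ : ℝ) (C gτ gc g₁ g₂ g₃ : ℝ → ℝ),
      0 < c₁ ∧ 0 < c₂ ∧ 0 < c₃ ∧ (∀ η : ℝ, 0 < η → η < 1 → 0 < C η) ∧
      (∀ ν : ℝ, 0 < ν → 0 < gτ ν ∧ 0 < gc ν ∧ 0 < g₁ ν ∧ 0 < g₂ ν ∧ 0 < g₃ ν) ∧
      MonotoneOn g₁ (Set.Ioi 0) ∧ MonotoneOn g₃ (Set.Ioi 0) ∧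
      Filter.Tendsto g₁ (𝓝[>] 0) (𝓝 0) ∧
      ∀ (ν : ℝ), 0 < ν → ∀ (ε : ℝ), 0 < ε → ε < 1 →
      ∀ (A B : Type*) [Fintype A] [Fintype B] [Nonempty A] [Nonempty B]
        [DecidableEq A] [DecidableEq B] (G : ZeroSumGame A B), 2 ≤ Amax A B →
      ∀ (M τ c : ℝ), M = (Amax A B : ℝ) → τ = gτ ν * ε / (12 * Real.log M) →
        c = gc ν * τ ^ 3 / (6 * M ^ 2) →
        (0 < c ∧ c < 1) ∧
        -- constant step sizes
        (∀ β : ℝ, β = g₁ ν * ε ^ (8 + ν) / (c₁ * M ^ 10) →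
          (0 < β ∧ g₃ ν * β < 1 ∧ β < 1) ∧
          G.expectedNashGap τ c (fun _ => β)
            (roundsConst (G.initialLyapunov τ) ε (g₃ ν) β) ≤ ε ∧
          ∃ K : ℕ, G.IsIterationComplexity τ c (fun _ => β) ε K ∧
            (K : ℝ) ≤ c₂ * M ^ 10 / (g₂ ν * ε ^ (8 + ν)) * (1 + Real.log (1 / ε))) ∧
        -- inverse polynomial step sizes
        (∀ β : ℝ, β = g₁ ν * ε ^ (8 + ν) / (c₃ * M ^ 10) →
          (0 < β ∧ β < 1) ∧
          ∀ η : ℝ, 0 < η → η < 1 →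
            (∀ k₀ : ℝ, (2 * η / β) ^ (1 / (1 - η)) ≤ k₀ →
              G.expectedNashGap τ c (polyStep β k₀ η)
                (roundsPoly (G.initialLyapunov τ) ε (g₃ ν) β k₀ η) ≤ ε) ∧
            ∀ k₀ : ℕ, k₀ = ⌈(2 * η / β) ^ (1 / (1 - η))⌉₊ →
              ∃ K : ℕ, G.IsIterationComplexity τ c (polyStep β k₀ η) ε K ∧
                (K : ℝ) ≤ C η *
                  (M ^ 10 / (g₂ ν * ε ^ (8 + ν)) * (1 + Real.log (1 / ε))) ^ (1 / (1 - η))) := by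
  -- `min ν 1` tends to 0 with `ν` and only shrinks `β`. The factors 4 and 9 come from `K ≤ (4 + log
  -- (1 / ε)) / β` and `K ≤ ((9 + log (1 / ε)) / β) ^ (1 / (1 - η))`.
  refine ⟨10 ^ 16, 4 * 10 ^ 16, 10 ^ 16, fun η => (9 * 10 ^ 16) ^ (1 / (1 - η)), fun _ => 1,
    fun _ => 1 / 8, fun ν => min ν 1, fun ν => min ν 1, fun _ => 1, by norm_num, by norm_num,
    by norm_num, fun η _ _ => by positivity,
    fun ν hν => ⟨one_pos, by norm_num, lt_min hν one_pos, lt_min hν one_pos, one_pos⟩,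
    fun x _ y _ hxy => min_le_min_right _ hxy, monotoneOn_const, ?_, ?_⟩
  · have h : Filter.Tendsto (fun ν : ℝ => min ν 1) (𝓝 0) (𝓝 (min 0 1)) :=
      (continuous_id.min continuous_const).tendsto 0
    rw [min_eq_left zero_le_one] at h
    exact h.mono_left nhdsWithin_le_nhds
  intro ν hν ε hε hε1 A B _ _ _ _ _ _ G hA M τ c hM hτ hc
  subst hM
  rw [one_mul] at hτ
  have hM' : (2 : ℝ) ≤ Amax A B := by exact_mod_cast hA
  set g := min ν 1 with hg
  have hg0 : 0 < g := lt_min hν one_pos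
  have hεν : 0 < ε ^ (8 + ν) := Real.rpow_pos_of_pos hε _
  have hβall : ∀ β : ℝ, β = g * ε ^ (8 + ν) / (10 ^ 16 * (Amax A B : ℝ) ^ 10) →
      0 < β ∧ β ≤ ε ^ 8 / (10 ^ 16 * (Amax A B : ℝ) ^ 10) := by
    rintro β rfl
    refine ⟨by positivity, div_le_div_of_nonneg_right ?_ (by positivity)⟩
    calc g * ε ^ (8 + ν) ≤ 1 * ε ^ (8 : ℝ) :=
          mul_le_mul (min_le_right _ _)
            (Real.rpow_le_rpow_of_exponent_ge hε hε1.le (by linarith)) hεν.le zero_le_one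
      _ = ε ^ 8 := by rw [one_mul]; exact_mod_cast Real.rpow_natCast ε 8
  have hpar := fun β hβ => parameter_bounds hM' hε hε1 hτ hc (hβall β hβ).1 (hβall β hβ).2
  obtain ⟨hτ0, hτM, hc0, hc1, -⟩ := hpar _ rfl
  have hV0 := G.lyapunovV_initialState_pos hτ0 hA
  have hV1 := G.lyapunovV_initialState_le hτ0
  have hW0 := G.lyapunovW_nonneg (initialState A B)
  have hW1 := G.lyapunovW_initialState_le
  have hWM : G.lyapunovW (initialState A B) / Amax A B ≤ 2 := by
    rw [div_le_iff₀ (by linarith)]; exact hW1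
  have hT0 : 0 < G.initialLyapunov τ := add_pos_of_pos_of_nonneg hV0 hW0
  have hT1 : G.initialLyapunov τ ≤ 4 * Amax A B := by rw [ZeroSumGame.initialLyapunov]; linarith
  have hLT : G.lyapunovV τ (initialState A B) + G.lyapunovW (initialState A B) / Amax A B
      ≤ G.initialLyapunov τ :=
    add_le_add_right (div_le_self hW0 (by linarith)) _
  -- The explicit round numbers use `T₁`, bounded here only by `4 A_max`; the complexity bounds use
  -- `T = 5` instead, so that no `log A_max` appears.
  have hL5 : G.lyapunovV τ (initialState A B) + G.lyapunovW (initialState A B) / Amax A B ≤ 5 := by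
    linarith
  have hlog := log_fifteen_div_le hε
  have hl0 : 0 ≤ Real.log (1 / ε) := Real.log_nonneg ((one_le_div hε).2 hε1.le)
  refine ⟨⟨hc0, hc1⟩, fun β hβ => ?_, fun β hβ => ?_⟩
  · obtain ⟨hβ0, hβ'⟩ := hβall β hβ
    obtain ⟨-, -, -, -, hβ1, -⟩ := hpar β hβ
    refine ⟨⟨hβ0, by rwa [one_mul], hβ1⟩,
      G.expectedNashGap_const_le hA hε hε1 hτ hc hβ0 hβ' hT0 hT1 hLT, ?_⟩
    obtain ⟨K, hK, hKle⟩ := G.exists_isIterationComplexity_le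
      (G.expectedNashGap_const_le hA hε hε1 hτ hc hβ0 hβ' (by norm_num : (0 : ℝ) < 5)
        (by linarith) hL5)
    refine ⟨K, hK, ?_⟩
    have h1 : (K : ℝ) ≤ roundsConst 5 ε 1 β := by exact_mod_cast hKle
    have h2 := roundsConst_le (T := 5) hε (by linarith) hβ0 hβ1
    have h3 : 4 * 10 ^ 16 * (Amax A B : ℝ) ^ 10 / (g * ε ^ (8 + ν)) = 4 / β := by
      rw [hβ]; field_simp; rfl
    rw [h3]
    have h4 : 1 ≤ 1 / β := (one_le_div hβ0).2 hβ1.le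
    calc (K : ℝ) ≤ (3 + Real.log (1 / ε)) / β + 1 / β := by
          have := div_le_div_of_nonneg_right hlog hβ0.le
          linarith
      _ = (4 + Real.log (1 / ε)) / β := by ring
      _ ≤ (4 + 4 * Real.log (1 / ε)) / β := by gcongr; linarith
      _ = _ := by ring
  · obtain ⟨hβ0, hβ'⟩ := hβall β hβ
    obtain ⟨-, -, -, -, hβ1, -⟩ := hpar β hβ
    refine ⟨⟨hβ0, hβ1⟩, fun η hη hη1 => ⟨fun k₀ hk₀ => ?_, fun k₀ hk₀ => ?_⟩⟩
    · exact G.expectedNashGap_poly_le hA hε hε1 hτ hc hβ0 hβ' hT0 hT1 hLT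
        (le_trans (by positivity) hk₀) hη hη1
    · obtain ⟨K, hK, hKle⟩ := G.exists_isIterationComplexity_le
        (G.expectedNashGap_poly_le hA hε hε1 hτ hc hβ0 hβ' (by norm_num : (0 : ℝ) < 5)
          (by linarith) hL5 (Nat.cast_nonneg k₀) hη hη1)
      refine ⟨K, hK, ?_⟩
      have h1 : (K : ℝ) ≤ roundsPoly 5 ε 1 β k₀ η := by exact_mod_cast hKle
      have h2 := roundsPoly_le (T := 5) (ε := ε) hβ0 hβ1 hη hη1 hk₀ (max_le (by linarith) hlog)
      have hη' : 0 < 1 - η := by linarith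
      refine (h1.trans h2).trans ?_
      have h3 : (Amax A B : ℝ) ^ 10 / (g * ε ^ (8 + ν)) = 1 / (10 ^ 16 * β) := by
        rw [hβ]; field_simp; rfl
      rw [h3, ← Real.mul_rpow (by norm_num) (by positivity)]
      apply Real.rpow_le_rpow (by positivity) _ (by positivity)
      have h4 : 9 * 10 ^ 16 * (1 / (10 ^ 16 * β) * (1 + Real.log (1 / ε)))
          = (9 + 9 * Real.log (1 / ε)) / β := by field_simp
      rw [h4]
      exact div_le_div_of_nonneg_right (by linarith) hβ0.le
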